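/- Let $\rho>0$ be constant, let $\xi\in\mathbb R^2$, and let the refractive index $n_0(z)$ of the half-space $z\ge 0$ be positive and twice continuously differentiable on $[0,\infty)$, with $\int_0^\infty n_0\,dz=\infty$. Let $y=\int_0^z n_0(s)\,ds\in[0,\infty)$ be the vertical travel time, write $n_0(y)$ for $n_0(z(y))$, and put $$\sigma(y)=\frac{n_0(y)}{\rho},\qquad q(y)=q(y,\xi)=-\frac{(\sqrt{\sigma(y)})''}{\sqrt{\sigma(y)}}-\frac{|\xi|^2}{n_0(y)^2},$$ where derivatives are with respect to $y$ (one-sided at $y=0$). Let $U^{(0)}=U^{(0)}(y,t)$, a twice differentiable function of $y\in[0,\infty)$ with values in $\mathcal D'(\mathbb R_t)$, be a solution of $$U^{(0)}_{tt}-\frac1{\sigma}\bigl(\sigma U^{(0)}_y\bigr)_y+\frac{|\xi|^2}{n_0^2}U^{(0)}=0,\qquad U^{(0)}\big|_{t<0}=0,\qquad U^{(0)}\big|_{y=0}=\delta(t)\sqrt{\frac{\rho}{n_0(0)}},$$ and let $r_0\in\mathcal D'(\mathbb R_t)$ be the response, defined by $U^{(0)}_y|_{y=0}=r_0/n_0(0)$.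 Put $$\psi_1=\sqrt{\sigma}\,U^{(0)},\qquad \psi_2=\partial_t\psi_1+\partial_y\psi_1,\qquad g(t)=\delta'(t)+\frac{n_0'(0)}{2n_0(0)}\delta(t)+\frac{r_0(t)}{\sqrt{\rho\, n_0(0)}},$$ where $n_0'(0)$ is the derivative in $y$. Then $q$ is continuous on $[0,\infty)$; the distributions $\psi_1-\delta(t-y)$ and $\psi_2$ are functions which vanish for $t<y$ and which on $t>y$ are continuous and extend continuously to $\{0\le y\le t\}$; and $g$ is a function which vanishes for $t<0$ and is continuous for $t>0$ up to $t=0$. Writing $\psi_1,\psi_2$ (on $0\le y\le t$) and $g$ (on $t\ge0$) for these continuous functions, one has for all $0\le y\le t$ $$\psi_1(y,t)=\int_0^y\psi_2(\eta,t+\eta-y)\,d\eta,$$ $$\psi_2(y,t)=-\int_0^y q(\eta)\,\psi_1(\eta,t-\eta+y)\,d\eta+g(t+y),$$ and for all $y\ge 0$ $$q(y)=-2\int_0^y q(\eta)\,\psi_1(\eta,2y-\eta)\,d\eta+2g(2y).$$ -/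

import Mathlib

open Set Filter MeasureTheory
open scoped Distributions LineDeriv

noncomputable section

/-- Real-valued distributions on the time axis. -/
abbrev TimeDistribution : Type := 𝓓'((⊤ : TopologicalSpace.Opens ℝ), ℝ)

/-- Vertical travel time `y = ∫₀ᶻ n₀(s) ds` down to the depth `z`. -/
def travelTime (n : ℝ → ℝ) (z : ℝ) : ℝ := ∫ s in (0 : ℝ)..z, n s

/-- The depth `z(y) ≥ 0` reached at travel time `y`, i.e. the inverse of `travelTime` on `[0, ∞)`. -/
def depth (n : ℝ → ℝ) : ℝ → ℝ := Function.invFunOn (travelTime n) (Ici 0)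

/-- The refractive index as a function of the travel time, `n₀(y) = n₀(z(y))`. -/
def indexTT (n : ℝ → ℝ) (y : ℝ) : ℝ := n (depth n y)

/-- The acoustic admittance `σ(y) = n₀(z(y)) / ρ`. -/
def admittance (n : ℝ → ℝ) (ρ : ℝ) (y : ℝ) : ℝ := indexTT n y / ρ

/-- The potential `q(y, ξ) = -(√σ)'' / √σ - |ξ|² / n₀²`; derivatives at `y = 0` are one-sided. -/
def potential (n : ℝ → ℝ) (ρ : ℝ) (ξ : EuclideanSpace ℝ (Fin 2)) (y : ℝ) : ℝ :=
  -(iteratedDerivWithin 2 (fun η => √(admittance n ρ η)) (Ici 0) y) / √(admittance n ρ y)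
    - ‖ξ‖ ^ 2 / indexTT n y ^ 2

/-- The `y`-derivative on the half-line `[0, ∞)` (one-sided at `0`) of a family of distributions
in time, taken in the topology of the space of distributions. -/
def dy (U : ℝ → TimeDistribution) (y : ℝ) : TimeDistribution := derivWithin U (Ici 0) y

/-- The causal solution `U(y) = U⁽⁰⁾(y, ·, ξ)` of the zero-order problem in travel-time coordinates
with boundary source `δ(t) √(ρ / n₀(0))`. It is a twice differentiable function of `y ∈ [0, ∞)`
with values in the distributions in `t`, so that its traces at `y = 0` make sense. -/
structure IsZeroOrderSolution (n : ℝ → ℝ) (ρ : ℝ) (ξ : EuclideanSpace ℝ (Fin 2))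
    (U : ℝ → TimeDistribution) : Prop where
  /-- `U = 0` for `t < 0` -/
  causal : ∀ y : ℝ, 0 ≤ y → Distribution.IsVanishingOn (U y) (Iio (0 : ℝ))
  /-- `U_y` exists -/
  differentiable : DifferentiableOn ℝ U (Ici 0)
  /-- `(σ U_y)_y` exists -/
  differentiable_flux : DifferentiableOn ℝ (fun y => admittance n ρ y • dy U y) (Ici 0)
  /-- `U_tt - σ⁻¹ (σ U_y)_y + |ξ|² n₀⁻² U = 0` -/
  wave : ∀ y : ℝ, 0 ≤ y →
    ∂_{(1 : ℝ)} (∂_{(1 : ℝ)} (U y))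
      - (1 / admittance n ρ y) • dy (fun η => admittance n ρ η • dy U η) y
      + (‖ξ‖ ^ 2 / indexTT n y ^ 2) • U y = 0
  /-- `U = δ(t) √(ρ / n₀(0))` at `y = 0` -/
  boundary : U 0 = √(ρ / indexTT n 0) • (Distribution.delta (0 : ℝ) : TimeDistribution)

/-- The response `r₀`, defined by `U_y = r₀ / n₀(0)` at `y = 0`. -/
def response (n : ℝ → ℝ) (U : ℝ → TimeDistribution) : TimeDistribution :=
  indexTT n 0 • dy U 0

/-- `ψ₁ = √σ U⁽⁰⁾` -/
def psiOne (n : ℝ → ℝ) (ρ : ℝ) (U : ℝ → TimeDistribution) (y : ℝ) : TimeDistribution :=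
  √(admittance n ρ y) • U y

/-- `ψ₂ = ∂ₜ ψ₁ + ∂_y ψ₁` -/
def psiTwo (n : ℝ → ℝ) (ρ : ℝ) (U : ℝ → TimeDistribution) (y : ℝ) : TimeDistribution :=
  ∂_{(1 : ℝ)} (psiOne n ρ U y) + dy (psiOne n ρ U) y

/-- The data `g = δ' + n₀'(0) / (2 n₀(0)) δ + r₀ / √(ρ n₀(0))`, where `n₀'(0)` is the derivative
with respect to the travel time. -/
def dataG (n : ℝ → ℝ) (ρ : ℝ) (r : TimeDistribution) : TimeDistribution :=
  ∂_{(1 : ℝ)} (Distribution.delta (0 : ℝ) : TimeDistribution)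
    + (derivWithin (indexTT n) (Ici 0) 0 / (2 * indexTT n 0)) •
      (Distribution.delta (0 : ℝ) : TimeDistribution)
    + (1 / √(ρ * indexTT n 0)) • r

/-- `T = θ(t - a) f(t)`: the distribution `T` is the function equal to `f` for `t > a` and to `0`
for `t < a`. -/
def IsFunctionAfter (T : TimeDistribution) (a : ℝ) (f : ℝ → ℝ) : Prop :=
  ∀ φ : 𝓓((⊤ : TopologicalSpace.Opens ℝ), ℝ), T φ = ∫ t in Ioi a, f t * φ t

end

/-!
The Liouville substitution `W = √σ U`, `V = ∂ₜ W + ∂_y W` turns the wave equation into the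
first-order system `W_y = V - ∂ₜ W`, `V_y = ∂ₜ V - q W` for curves of distributions, with
`W(0) = δ` and `V(0) = g` (`hasDerivWithinAt_psiOne'`, `hasDerivWithinAt_psiTwo`, `psiOne_zero`,
`psiTwo_zero`). Distributions carry the topology of uniform convergence on compact sets of test
functions, so the pairing `y ↦ ⟨T(y), f(y)⟩` of two differentiable curves obeys the product rule.
Pairing with moving translates of a test function `φ` integrates the system along its
characteristics:

* `⟨W(y), φ⟩ = φ(y) + ∫₀ʸ ⟨V(η), φ(· + y - η)⟩ dη`,
* `⟨V(y), φ⟩ = ∫_y^L q(s) ⟨W(s), φ(· + s - y)⟩ ds` for large `L`,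

where causality removes the end term at `L` of the second identity, because the test function has
by then been moved into `t < 0`.

For functions, the system is a Goursat problem on the sector `0 ≤ y ≤ t`:
`ψ₂(y, t) = q((t + y) / 2) / 2 + ∫ q(s) ψ₁(s, t + y - s) ds` over `y ≤ s ≤ (t + y) / 2`, and
`ψ₁(y, t) = ∫₀ʸ ψ₂(η, t + η - y) dη`. The free term is the trace that the pulse `δ(t - y)` leaves on
the diagonal. A weighted contraction solves it (`exists_goursat_solution`). By Fubini, the
distribution `δ(t - y) + θ(t - y) ψ₁`, together with `θ(t - y) ψ₂`, satisfies the two characteristic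
identities. Their difference with `W`, `V`, as a function of `y` and of the translation `a` of the
test function, solves a homogeneous Volterra system and vanishes for `a` very negative, so it is
zero (`eq_zero_of_homogeneous_system`). Hence `ψ₁`, `ψ₂` represent the given solution, whatever it
is (`isFunctionAfter_of_goursat_solution`). With `g(t) = ψ₂(0, t)`, the second integral equation is
the difference of the Goursat equation at `(y, t)` and at `(0, t + y)`, and the third is the Goursat
equation at `(0, 2 y)`.
-/

open scoped Topology

noncomputable section

/-! ### Derivatives of curves in topological vector spaces

The space of distributions is not normed, so the calculus of curves in it goes through difference
quotients. -/

section TVS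

variable {F : Type*} [AddCommGroup F] [Module ℝ F] [TopologicalSpace F] [ContinuousSMul ℝ F]

theorem DifferentiableWithinAt.hasDerivWithinAt_tvs {f : ℝ → F} {s : Set ℝ} {x : ℝ}
    (hd : DifferentiableWithinAt ℝ f s x) : HasDerivWithinAt f (_root_.derivWithin f s x) s x := by
  rw [_root_.derivWithin, fderivWithin]
  split_ifs with h1
  · simpa using h1.hasDerivWithinAt
  · exact (Classical.choose_spec hd).hasDerivWithinAt

variable [IsTopologicalAddGroup F]

theorem hasDerivWithinAt_iff_tendsto_slope_tvs {f : ℝ → F} {f' : F} {s : Set ℝ} {x : ℝ} :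
    HasDerivWithinAt f f' s x ↔ Tendsto (slope f x) (𝓝[s \ {x}] x) (𝓝 f') := by
  have key : HasDerivWithinAt f f' (s \ {x}) x ↔ Tendsto (slope f x) (𝓝[s \ {x}] x) (𝓝 f') := by
    rw [hasDerivWithinAt_iff_hasFDerivWithinAt, hasFDerivWithinAt_iff_isLittleOTVS,
      Asymptotics.isLittleOTVS_iff_tendsto_inv_smul, ← tendsto_sub_nhds_zero_iff (u := slope f x)]
    · refine tendsto_congr' ?_
      filter_upwards [self_mem_nhdsWithin] with z hz
      have hz' : z - x ≠ 0 := sub_ne_zero.2 hz.2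
      simp [slope, smul_sub, smul_smul, inv_mul_cancel₀ hz']
    · filter_upwards with z hz
      have : z = x := by linarith
      simp [this]
  rw [← key, hasDerivWithinAt_iff_hasFDerivWithinAt, hasDerivWithinAt_iff_hasFDerivWithinAt,
    hasFDerivWithinAt_sdiff_singleton_self]

theorem HasDerivWithinAt.continuousWithinAt_tvs {f : ℝ → F} {f' : F} {s : Set ℝ} {x : ℝ}
    (h : HasDerivWithinAt f f' s x) : ContinuousWithinAt f s x := by
  rw [hasDerivWithinAt_iff_tendsto_slope_tvs] at h
  rw [← continuousWithinAt_sdiff_self]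
  have h1 : Tendsto (fun z : ℝ => z - x) (𝓝[s \ {x}] x) (𝓝 0) := by
    have : Tendsto (fun z : ℝ => z - x) (𝓝 x) (𝓝 (x - x)) :=
      (continuous_id.sub continuous_const).tendsto x
    rw [sub_self] at this
    exact this.mono_left nhdsWithin_le_nhds
  have h2 := (h1.smul h).add_const (f x)
  rw [zero_smul, zero_add] at h2
  refine h2.congr' ?_
  filter_upwards with z
  simp

theorem HasDerivWithinAt.derivWithin_tvs [T2Space F] {f : ℝ → F} {f' : F} {s : Set ℝ} {x : ℝ}
    (h : HasDerivWithinAt f f' s x) [(𝓝[s \ {x}] x).NeBot] :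
    _root_.derivWithin f s x = f' :=
  tendsto_nhds_unique (hasDerivWithinAt_iff_tendsto_slope_tvs.1
    (DifferentiableWithinAt.hasDerivWithinAt_tvs ⟨_, h.hasFDerivWithinAt⟩))
    (hasDerivWithinAt_iff_tendsto_slope_tvs.1 h)

theorem HasDerivWithinAt.congr_tvs {f g : ℝ → F} {f' : F} {s : Set ℝ} {x : ℝ}
    (h : HasDerivWithinAt f f' s x) (hfg : ∀ y ∈ s, g y = f y) (hx : x ∈ s) :
    HasDerivWithinAt g f' s x := by
  rw [hasDerivWithinAt_iff_tendsto_slope_tvs] at *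
  refine h.congr' ?_
  filter_upwards [self_mem_nhdsWithin] with z hz
  simp only [slope, hfg z hz.1, hfg x hx]

theorem HasDerivWithinAt.add_tvs {f g : ℝ → F} {f' g' : F} {s : Set ℝ} {x : ℝ}
    (hf : HasDerivWithinAt f f' s x) (hg : HasDerivWithinAt g g' s x) :
    HasDerivWithinAt (fun y => f y + g y) (f' + g') s x := by
  rw [hasDerivWithinAt_iff_tendsto_slope_tvs] at *
  refine (hf.add hg).congr fun z => ?_
  simp only [slope, vsub_eq_sub, ← smul_add]
  congr 1; abel

theorem HasDerivWithinAt.clm_apply_tvs {G : Type*} [AddCommGroup G] [Module ℝ G]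
    [TopologicalSpace G] [IsTopologicalAddGroup G] [ContinuousSMul ℝ G] (L : F →L[ℝ] G)
    {f : ℝ → F} {f' : F} {s : Set ℝ} {x : ℝ}
    (hf : HasDerivWithinAt f f' s x) : HasDerivWithinAt (fun y => L (f y)) (L f') s x := by
  rw [hasDerivWithinAt_iff_tendsto_slope_tvs] at *
  refine ((L.continuous.tendsto _).comp hf).congr fun z => ?_
  simp [slope]

theorem HasDerivWithinAt.smul_tvs {c : ℝ → ℝ} {c' : ℝ} {f : ℝ → F} {f' : F} {s : Set ℝ} {x : ℝ}
    (hc : HasDerivWithinAt c c' s x) (hf : HasDerivWithinAt f f' s x) :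
    HasDerivWithinAt (fun y => c y • f y) (c' • f x + c x • f') s x := by
  have hcont := (hf.continuousWithinAt_tvs).mono (sdiff_subset (t := {x}))
  rw [hasDerivWithinAt_iff_tendsto_slope_tvs] at *
  refine ((hc.smul hcont).add (hf.const_smul (c x))).congr fun z => ?_
  simp only [slope, vsub_eq_sub, smul_sub, sub_smul, smul_eq_mul, mul_sub, smul_smul]
  rw [mul_comm (c x)]
  abel

end TVS

/-! ### Pairings of curves of distributions and of test functions -/

/-- Test functions on the time axis. -/
abbrev TimeTest : Type := 𝓓((⊤ : TopologicalSpace.Opens ℝ), ℝ)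

theorem continuous_distribution (T : TimeDistribution) : Continuous fun φ : TimeTest => T φ :=
  ContinuousLinearMap.continuous T

/-- The pairing is only separately continuous, but it is jointly continuous along test functions
that stay in a compact set, on which distributions converge uniformly. -/
theorem tendsto_apply_of_compact {ι : Type*} {l : Filter ι} {T : ι → TimeDistribution}
    {T₀ : TimeDistribution} {f : ι → TimeTest} {f₀ : TimeTest}
    (hT : Tendsto T l (𝓝 T₀)) (hf : Tendsto f l (𝓝 f₀)) {K : Set TimeTest} (hK : IsCompact K)
    (hfK : ∀ᶠ i in l, f i ∈ K) : Tendsto (fun i => T i (f i)) l (𝓝 (T₀ f₀)) := by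
  have h1 : Tendsto (fun i => (T i - T₀) (f i)) l (𝓝 0) := by
    rw [← tendsto_sub_nhds_zero_iff (u := T)] at hT
    rw [tendsto_def]
    intro V hV
    have := (CompactConvergenceCLM.hasBasis_nhds_zero (σ := RingHom.id ℝ) (E := TimeTest)
      (F := ℝ)).mem_of_mem (i := (K, V)) ⟨hK, hV⟩
    filter_upwards [hT this, hfK] with i hi hi'
    exact hi _ hi'
  have h2 : Tendsto (fun i => T₀ (f i)) l (𝓝 (T₀ f₀)) :=
    ((continuous_distribution T₀).tendsto _).comp hf
  have := h1.add h2
  rw [zero_add] at this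
  refine this.congr fun i => ?_
  rw [sub_apply]; ring

theorem continuousOn_apply_curve {X : Type*} [TopologicalSpace X] [LocallyCompactSpace X]
    {s : Set X} {T : X → TimeDistribution}
    {f : X → TimeTest} (hT : ContinuousOn T s) (hf : Continuous f) :
    ContinuousOn (fun x => T x (f x)) s := by
  intro x hx
  obtain ⟨K, hK, hxK⟩ := exists_compact_mem_nhds x
  exact tendsto_apply_of_compact (hT x hx) (hf.continuousWithinAt) (hK.image hf)
    (mem_nhdsWithin_of_mem_nhds (mem_of_superset hxK fun y hy => mem_image_of_mem f hy))

/-- Product rule for the pairing of a curve of distributions with a curve of test functions. -/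
theorem hasDerivWithinAt_apply_curve {s : Set ℝ} {T : ℝ → TimeDistribution} {T' : TimeDistribution}
    {f : ℝ → TimeTest} {f' : TimeTest} {x : ℝ} (hT : HasDerivWithinAt T T' s x)
    (hf : Continuous f) (hf' : HasDerivWithinAt f f' s x) :
    HasDerivWithinAt (fun y => T y (f y)) (T' (f x) + T x f') s x := by
  obtain ⟨K, hK, hxK⟩ := exists_compact_mem_nhds x
  have hd := continuous_distribution (T x)
  rw [hasDerivWithinAt_iff_tendsto_slope_tvs] at *
  have h1 := tendsto_apply_of_compact hT (hf.continuousWithinAt (s := s \ {x}) (x := x))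
    (hK.image hf)
    (mem_nhdsWithin_of_mem_nhds (mem_of_superset hxK fun y hy => mem_image_of_mem f hy))
  have h2 := (hd.tendsto _).comp hf'
  refine (h1.add h2).congr fun z => ?_
  have h3 : T x (slope f x z) = (z - x)⁻¹ * (T x (f z) - T x (f x)) := by
    rw [slope, vsub_eq_sub]
    exact (map_smul (T x) _ _).trans (by rw [map_sub, smul_eq_mul])
  change (slope T x z) (f z) + T x (slope f x z) = _
  rw [h3]
  simp only [slope, vsub_eq_sub, smul_apply, sub_apply, smul_eq_mul]
  ring

/-! ### Translates of test functions -/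

/-- Convergence to zero in the space of test functions: supports in a common compact set, and
uniform convergence of every derivative. -/
theorem tendsto_timeTest_zero {ι : Type*} {l : Filter ι} {f : ι → TimeTest}
    (K : TopologicalSpace.Compacts ℝ) (hK : ∀ᶠ i in l, Function.support (f i) ⊆ K)
    (h : ∀ k : ℕ, ∀ ε > 0, ∀ᶠ i in l, ∀ x, ‖iteratedDeriv k (f i) x‖ ≤ ε) :
    Tendsto f l (𝓝 0) := by
  classical
  let F : ι → ContDiffMapSupportedIn ℝ ℝ ⊤ K := fun i =>
    if hi : Function.support (f i) ⊆ K then .of_support_subset (f i).contDiff hi else 0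
  have hKsub : (K : Set ℝ) ⊆ ((⊤ : TopologicalSpace.Opens ℝ) : Set ℝ) := fun _ _ => trivial
  have hF : Tendsto F l (𝓝 0) := by
    rw [(ContDiffMapSupportedIn.withSeminorms ℝ ℝ ℝ ⊤ K).tendsto_nhds]
    intro k ε hε
    filter_upwards [hK, h k (ε / 2) (by positivity)] with i hi hi'
    refine lt_of_le_of_lt ?_ (half_lt_self hε)
    rw [sub_zero, ContDiffMapSupportedIn.seminorm_le_iff ℝ (by positivity)]
    intro _ x _
    rw [norm_iteratedFDeriv_eq_norm_iteratedDeriv]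
    have : (F i : ℝ → ℝ) = f i := by
      simp only [F, hi, dif_pos]; rfl
    rw [this]
    exact hi' x
  have := ((TestFunction.continuous_ofSupportedIn (n := ⊤) (F := ℝ) hKsub).tendsto 0).comp hF
  refine (Tendsto.congr' ?_ this)
  filter_upwards [hK] with i hi
  ext x
  simp only [Function.comp_apply, F, hi, dif_pos]; rfl

/-- The translate `x ↦ φ (x - a)` of a test function. -/
def shift (φ : TimeTest) (a : ℝ) : TimeTest where
  toFun x := φ (x - a)
  contDiff' := φ.contDiff.comp (contDiff_id.sub contDiff_const)
  hasCompactSupport' := φ.hasCompactSupport.comp_homeomorph (Homeomorph.subRight a)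
  tsupport_subset' := fun _ _ => trivial

@[simp] theorem shift_apply (φ : TimeTest) (a x : ℝ) : shift φ a x = φ (x - a) := rfl

theorem shift_zero (φ : TimeTest) : shift φ 0 = φ := by ext x; simp

theorem shift_shift (φ : TimeTest) (a b : ℝ) :
    shift (shift φ a) b = shift φ (a + b) := by
  ext x; simp only [shift_apply]; congr 1; ring

theorem timeDeriv_apply (φ : TimeTest) (x : ℝ) : (∂_{(1 : ℝ)} φ : TimeTest) x = deriv φ x := by
  rw [TestFunction.lineDerivOp_eq_lineDerivCLM ℝ, TestFunction.lineDerivCLM_apply_of_le (by simp)]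
  simp [lineDeriv, deriv_comp_const_add]

theorem timeDeriv_shift (φ : TimeTest) (a : ℝ) :
    (∂_{(1 : ℝ)} (shift φ a) : TimeTest) = shift (∂_{(1 : ℝ)} φ) a := by
  ext x
  rw [timeDeriv_apply, shift_apply, timeDeriv_apply]
  exact deriv_comp_sub_const φ a x

theorem exists_forall_le_abs_eq_zero (φ : TimeTest) :
    ∃ M : ℝ, 0 < M ∧ ∀ x, M ≤ |x| → φ x = 0 := by
  obtain ⟨M, hM⟩ := φ.hasCompactSupport.isCompact.isBounded.exists_norm_le
  refine ⟨|M| + 1, by positivity, fun x hx => ?_⟩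
  by_contra h
  have := hM x (subset_tsupport _ h)
  rw [Real.norm_eq_abs] at this
  linarith [le_abs_self M]

/-- Translation of a test function is a differentiable curve in the space of test functions. For
each derivative, the remainder of the difference quotient is bounded by `C |t - a|` with `C` a bound
on the derivative two orders higher. -/
theorem hasDerivWithinAt_shift (φ : TimeTest) (a : ℝ) (s : Set ℝ) :
    HasDerivWithinAt (shift φ) (-shift (∂_{(1 : ℝ)} φ) a) s a := by
  obtain ⟨M, hM, hφ⟩ := exists_forall_le_abs_eq_zero φ
  rw [hasDerivWithinAt_iff_tendsto_slope_tvs]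
  rw [← tendsto_sub_nhds_zero_iff]
  have hsm : ∀ k : ℕ, Differentiable ℝ (iteratedDeriv k φ) := fun k =>
    (φ.contDiff.differentiable_iteratedDeriv k (by exact_mod_cast WithTop.coe_lt_top _))
  have hd' : ∀ k x, HasDerivAt (iteratedDeriv k φ) (iteratedDeriv (k + 1) φ x) x := fun k x => by
    rw [iteratedDeriv_succ]; exact (hsm k x).hasDerivAt
  have hbd : ∀ k : ℕ, ∃ C, 0 ≤ C ∧ ∀ x, ‖iteratedDeriv k φ x‖ ≤ C := by
    intro k
    obtain ⟨C, hC⟩ := (φ.contDiff.continuous_iteratedFDeriv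
      (m := k) (by exact_mod_cast le_top)).bounded_above_of_compact_support
      (φ.hasCompactSupport.iteratedFDeriv k)
    simp only [norm_iteratedFDeriv_eq_norm_iteratedDeriv] at hC
    exact ⟨C, (norm_nonneg _).trans (hC 0), hC⟩
  have hnear : ∀ᶠ t in 𝓝[s \ {a}] a, |t - a| < 1 ∧ t ≠ a := by
    have h1 : ∀ᶠ t in 𝓝[s \ {a}] a, t ∈ Metric.ball a 1 :=
      mem_nhdsWithin_of_mem_nhds (Metric.ball_mem_nhds a one_pos)
    filter_upwards [h1, self_mem_nhdsWithin] with t ht ht'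
    exact ⟨by simpa [Real.dist_eq] using ht, ht'.2⟩
  refine tendsto_timeTest_zero ⟨Metric.closedBall 0 (M + |a| + 1), isCompact_closedBall _ _⟩ ?_ ?_
  -- all translates by `t` with `|t - a| < 1` live on a common ball
  · filter_upwards [hnear] with t ht x hx
    by_contra hxK
    have hxK' : M + |a| + 1 < |x| := by simpa using hxK
    have h0 : ∀ b, |b| ≤ |a| + 1 → M ≤ |x - b| := fun b hb => by
      linarith [abs_sub_abs_le_abs_sub x b]
    have hta : |t| ≤ |a| + 1 := by linarith [abs_sub_abs_le_abs_sub t a, ht.1]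
    have hda : deriv φ (x - a) = 0 := by
      have : M < |x - a| := by linarith [abs_sub_abs_le_abs_sub x a]
      have hev : φ =ᶠ[𝓝 (x - a)] fun _ => 0 := by
        filter_upwards [(isOpen_lt continuous_const continuous_abs).mem_nhds this] with z hz
        exact hφ z (le_of_lt hz)
      rw [hev.deriv_eq]; simp
    apply hx
    simp [slope, timeDeriv_apply, hφ _ (h0 t hta), hφ _ (h0 a (by linarith)), hda]
  · intro k ε hε
    obtain ⟨C, hC0, hC⟩ := hbd (k + 2)
    have hsmall : ∀ᶠ t in 𝓝[s \ {a}] a, t ∈ Metric.ball a (ε / (C + 1)) :=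
      mem_nhdsWithin_of_mem_nhds (Metric.ball_mem_nhds a (by positivity))
    filter_upwards [hnear, hsmall] with t ht hts x
    have hta : t - a ≠ 0 := sub_ne_zero.2 ht.2
    have hts' : |t - a| < ε / (C + 1) := by simpa [Real.dist_eq] using hts
    have hform : iteratedDeriv k (slope (shift φ) a t - -shift (∂_{(1 : ℝ)} φ) a : TimeTest) x
        = (t - a)⁻¹ * (iteratedDeriv k φ (x - t) - iteratedDeriv k φ (x - a)
          + (t - a) * iteratedDeriv (k + 1) φ (x - a)) := by
      have e1 : ((slope (shift φ) a t - -shift (∂_{(1 : ℝ)} φ) a : TimeTest) : ℝ → ℝ)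
          = fun x => (t - a)⁻¹ * (φ (x - t) - φ (x - a)) + deriv φ (x - a) := by
        ext z
        simp [slope, timeDeriv_apply]
      have hc : ∀ b, ContDiff ℝ k fun x => φ (x - b) := fun b =>
        (φ.contDiff.of_le (by exact_mod_cast le_top)).comp (contDiff_id.sub contDiff_const)
      have hcd : ContDiff ℝ k fun x => deriv φ (x - a) := by
        have : ContDiff ℝ k (deriv φ) := by
          refine ((contDiff_succ_iff_deriv (n := k)).1 (φ.contDiff.of_le ?_)).2.2
          exact_mod_cast le_top
        exact this.comp (contDiff_id.sub contDiff_const)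
      rw [e1, iteratedDeriv_fun_add (contDiff_const.mul ((hc t).sub (hc a))).contDiffAt
        hcd.contDiffAt, iteratedDeriv_const_mul_field,
        iteratedDeriv_fun_sub (hc t).contDiffAt (hc a).contDiffAt]
      rw [iteratedDeriv_comp_sub_const, iteratedDeriv_comp_sub_const,
        iteratedDeriv_comp_sub_const k (deriv φ), iteratedDeriv_succ']
      field_simp
    -- mean value inequality for `r ↦ φ⁽ᵏ⁾(x - r) + (r - a) φ⁽ᵏ⁺¹⁾(x - a)`, whose derivative
    -- is small near `r = a` because `φ⁽ᵏ⁺¹⁾` is Lipschitz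
    have hmv : ‖(iteratedDeriv k φ (x - t) + (t - a) * iteratedDeriv (k + 1) φ (x - a))
        - (iteratedDeriv k φ (x - a) + (a - a) * iteratedDeriv (k + 1) φ (x - a))‖
        ≤ C * |t - a| * ‖t - a‖ := by
      refine (convex_uIcc a t).norm_image_sub_le_of_norm_hasDerivWithin_le
        (f := fun r => iteratedDeriv k φ (x - r) + (r - a) * iteratedDeriv (k + 1) φ (x - a))
        (f' := fun r => -iteratedDeriv (k + 1) φ (x - r) + iteratedDeriv (k + 1) φ (x - a))
        (fun r _ => ?_) (fun r hr => ?_) left_mem_uIcc right_mem_uIcc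
      · have h1 : HasDerivAt (fun r => iteratedDeriv k φ (x - r))
            (iteratedDeriv (k + 1) φ (x - r) * (-1)) r :=
          (hd' k (x - r)).comp r ((hasDerivAt_id r).const_sub x)
        have h2 := ((hasDerivAt_id r).sub_const a).mul_const (iteratedDeriv (k + 1) φ (x - a))
        have h4 := (h1.add h2).hasDerivWithinAt (s := uIcc a t)
        rw [mul_neg_one, one_mul] at h4
        exact h4
      · have h3 := Convex.norm_image_sub_le_of_norm_hasDerivWithin_le
          (f := iteratedDeriv (k + 1) φ) (fun z _ => (hd' (k + 1) z).hasDerivWithinAt)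
          (fun z _ => hC z) convex_univ (mem_univ (x - r)) (mem_univ (x - a))
        rw [neg_add_eq_sub]
        refine h3.trans ?_
        gcongr
        rw [show x - a - (x - r) = r - a by ring, Real.norm_eq_abs]
        exact abs_sub_left_of_mem_uIcc hr
    rw [hform, norm_mul, norm_inv, inv_mul_le_iff₀ (by simpa using hta)]
    rw [sub_self, zero_mul, add_zero, add_sub_right_comm] at hmv
    refine hmv.trans ?_
    rw [Real.norm_eq_abs, mul_comm]
    gcongr
    have : |t - a| * (C + 1) < ε := by rwa [lt_div_iff₀ (by positivity)] at hts'
    nlinarith [abs_nonneg (t - a)]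

theorem continuous_shift (φ : TimeTest) : Continuous (shift φ) := by
  rw [continuous_iff_continuousAt]
  intro a
  have := (hasDerivWithinAt_shift φ a univ).continuousWithinAt_tvs
  rwa [continuousWithinAt_univ] at this

/-! ### Integration along characteristics -/

theorem hasDerivWithinAt_shift_neg (φ : TimeTest) (a : ℝ) (s : Set ℝ) :
    HasDerivWithinAt (fun η => shift φ (-η)) (shift (∂_{(1 : ℝ)} φ) (-a)) s a := by
  have h := hasDerivWithinAt_shift φ (-a) univ
  rw [hasDerivWithinAt_iff_tendsto_slope_tvs] at *
  have hneg : Tendsto (fun t : ℝ => -t) (𝓝[s \ {a}] a) (𝓝[univ \ {-a}] (-a)) := by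
    refine tendsto_nhdsWithin_of_tendsto_nhds_of_eventually_within _
      ((continuous_neg.tendsto a).mono_left nhdsWithin_le_nhds) ?_
    filter_upwards [self_mem_nhdsWithin] with t ht
    exact ⟨trivial, fun h => ht.2 (neg_injective h)⟩
  have h2 := (h.comp hneg).neg
  rw [neg_neg] at h2
  refine h2.congr fun t => ?_
  simp only [slope, Function.comp_apply, vsub_eq_sub]
  rw [← neg_smul]
  congr 1
  rw [← inv_neg]; congr 1; ring

theorem timeDeriv_distribution_apply (T : TimeDistribution) (φ : TimeTest) :
    (∂_{(1 : ℝ)} T : TimeDistribution) φ = -T (∂_{(1 : ℝ)} φ) := by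
  rw [Distribution.lineDerivOp_apply_apply, map_neg]

theorem tsupport_subset_Iio_of_eq_zero {φ : TimeTest} {c b : ℝ} (hcb : c < b)
    (h : ∀ x, c ≤ x → φ x = 0) : tsupport φ ⊆ Iio b := by
  have : tsupport φ ⊆ Iic c := by
    refine closure_minimal (fun x hx => ?_) isClosed_Iic
    by_contra hc
    exact hx (h x (le_of_lt (not_le.1 hc)))
  exact this.trans fun x hx => lt_of_le_of_lt hx hcb

theorem tsupport_timeDeriv_subset (φ : TimeTest) :
    tsupport (∂_{(1 : ℝ)} φ : TimeTest) ⊆ tsupport φ := by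
  have : ((∂_{(1 : ℝ)} φ : TimeTest) : ℝ → ℝ) = deriv φ := funext (timeDeriv_apply φ)
  rw [this]
  exact closure_minimal support_deriv_subset (isClosed_tsupport _)

theorem neBot_nhdsWithin_Ici_diff {y : ℝ} (hy : 0 ≤ y) : (𝓝[Ici (0 : ℝ) \ {y}] y).NeBot := by
  have h : (𝓝[>] y).NeBot := inferInstance
  exact h.mono (nhdsWithin_mono _ fun z hz => ⟨hy.trans (le_of_lt hz), ne_of_gt hz⟩)

theorem integral_eq_sub_of_hasDerivWithinAt_Ici {f f' : ℝ → ℝ} {a b : ℝ} (ha : 0 ≤ a) (hab : a ≤ b)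
    (hf : ∀ y, 0 ≤ y → HasDerivWithinAt f (f' y) (Ici 0) y) (hf' : ContinuousOn f' (Ici 0)) :
    ∫ y in a..b, f' y = f b - f a := by
  have hsub : Icc a b ⊆ Ici 0 := fun z hz => ha.trans hz.1
  refine intervalIntegral.integral_eq_sub_of_hasDeriv_right_of_le hab
    (fun z hz => ((hf z (hsub hz)).continuousWithinAt).mono hsub) (fun z hz => ?_)
    ((hf'.mono hsub).intervalIntegrable_of_Icc hab)
  have hz0 : 0 ≤ z := ha.trans hz.1.le
  exact (hf z hz0).mono fun w hw => hz0.trans (le_of_lt hw)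

section Characteristics

variable {W V : ℝ → TimeDistribution} {q : ℝ → ℝ}

theorem continuousOn_of_forall_hasDerivWithinAt {T T' : ℝ → TimeDistribution}
    (h : ∀ y, 0 ≤ y → HasDerivWithinAt T (T' y) (Ici 0) y) : ContinuousOn T (Ici 0) :=
  fun y hy => (h y hy).continuousWithinAt_tvs

/-- Integration of `W_y + ∂ₜ W = V` along `t - y = const`: under the pairing, the moving translate
`η ↦ φ(x - (η - y))` cancels the time derivative. -/
theorem apply_eq_along_forward_characteristic
    (hW : ∀ y, 0 ≤ y → HasDerivWithinAt W (V y - ∂_{(1 : ℝ)} (W y)) (Ici 0) y)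
    (hVc : ContinuousOn V (Ici 0)) (φ : TimeTest) {y : ℝ} (hy : 0 ≤ y) :
    W y φ = W 0 (shift φ (-y)) + ∫ η in (0 : ℝ)..y, V η (shift φ (η - y)) := by
  have key := integral_eq_sub_of_hasDerivWithinAt_Ici (a := 0) (b := y)
    (f := fun η => W η (shift (shift φ (-y)) η)) (f' := fun η => V η (shift (shift φ (-y)) η))
    le_rfl hy (fun η hη => ?_) (continuousOn_apply_curve hVc (continuous_shift _))
  · simp only [shift_shift] at key
    rw [add_zero, neg_add_cancel, shift_zero] at key
    simp only [sub_eq_neg_add _ y, key]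
    ring
  · have h := hasDerivWithinAt_apply_curve (hW η hη) (continuous_shift (shift φ (-y)))
      (hasDerivWithinAt_shift (shift φ (-y)) η (Ici 0))
    convert h using 1
    rw [sub_apply, timeDeriv_distribution_apply, timeDeriv_shift, map_neg]
    ring

/-- Integration of `V_y - ∂ₜ V = -q W` along `t + y = const`, from `y` up to a larger `Y`. -/
theorem apply_eq_along_backward_characteristic
    (hWc : ContinuousOn W (Ici 0)) (hq : ContinuousOn q (Ici 0))
    (hV : ∀ y, 0 ≤ y → HasDerivWithinAt V (∂_{(1 : ℝ)} (V y) - q y • W y) (Ici 0) y)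
    (φ : TimeTest) {y Y : ℝ} (hy : 0 ≤ y) (hY : y ≤ Y) :
    V y φ = V Y (shift φ (y - Y)) + ∫ η in y..Y, q η * W η (shift φ (y - η)) := by
  have key := integral_eq_sub_of_hasDerivWithinAt_Ici (a := y) (b := Y)
    (f := fun η => V η (shift (shift φ y) (-η)))
    (f' := fun η => -(q η * W η (shift (shift φ y) (-η))))
    hy hY (fun η hη => ?_) (hq.mul
      (continuousOn_apply_curve hWc ((continuous_shift _).comp continuous_neg))).neg
  · simp only [shift_shift, ← sub_eq_add_neg] at key
    rw [sub_self, shift_zero, intervalIntegral.integral_neg] at key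
    linarith
  · have h := hasDerivWithinAt_apply_curve (hV η hη)
      (f := fun η => shift (shift φ y) (-η)) ((continuous_shift (shift φ y)).comp continuous_neg)
      (hasDerivWithinAt_shift_neg (shift φ y) η (Ici 0))
    convert h using 1
    rw [sub_apply, timeDeriv_distribution_apply, smul_apply, timeDeriv_shift,
      timeDeriv_shift, smul_eq_mul]
    ring

theorem vanishing_of_causal
    (hcausal : ∀ y, 0 ≤ y → Distribution.IsVanishingOn (W y) (Iio (0 : ℝ)))
    (hW : ∀ y, 0 ≤ y → HasDerivWithinAt W (V y - ∂_{(1 : ℝ)} (W y)) (Ici 0) y) {y : ℝ}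
    (hy : 0 ≤ y) : Distribution.IsVanishingOn (V y) (Iio (0 : ℝ)) := by
  intro φ hφ
  have := neBot_nhdsWithin_Ici_diff hy
  have h1 := hasDerivWithinAt_apply_curve (hW y hy) (continuous_const (y := φ))
    ((hasDerivWithinAt_iff_tendsto_slope_tvs (f' := (0 : TimeTest))).2 <| by
      refine tendsto_const_nhds.congr fun z => ?_
      simp [slope])
  have h2 : HasDerivWithinAt (fun η => W η φ) 0 (Ici 0) y :=
    (hasDerivWithinAt_const y (Ici 0) (0 : ℝ)).congr (fun z hz => hcausal z hz φ hφ)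
      (hcausal y hy φ hφ)
  have h3 := tendsto_nhds_unique (hasDerivWithinAt_iff_tendsto_slope_tvs.1 h1)
    (hasDerivWithinAt_iff_tendsto_slope_tvs.1 h2)
  rw [sub_apply, timeDeriv_distribution_apply, map_zero,
    hcausal y hy _ ((tsupport_timeDeriv_subset φ).trans hφ)] at h3
  simpa using h3

/-- A causal distribution does not see a test function that is translated into `t < 0`. -/
theorem apply_shift_eq_zero {T : TimeDistribution}
    (hT : Distribution.IsVanishingOn T (Iio (0 : ℝ))) {φ : TimeTest} {M a : ℝ}
    (hφ : ∀ x, M ≤ |x| → φ x = 0) (ha : a < -M) : T (shift φ a) = 0 := by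
  refine hT _ (tsupport_subset_Iio_of_eq_zero (c := M + a) (by linarith) fun x hx => ?_)
  exact hφ _ (le_trans (by linarith) (le_abs_self _))

end Characteristics

/-! ### The travel-time coordinate -/

section TravelTime

variable {n : ℝ → ℝ}

theorem hasDerivWithinAt_travelTime (hn : ContinuousOn n (Ici 0)) {z : ℝ} (hz : 0 ≤ z) :
    HasDerivWithinAt (travelTime n) (n z) (Ici 0) z := by
  have hc : Continuous fun s => n (max s 0) :=
    hn.comp_continuous (f := fun s => max s 0) (by fun_prop) fun s => le_max_right s 0
  have h := (hc.integral_hasStrictDerivAt 0 z).hasDerivAt.hasDerivWithinAt (s := Ici 0)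
  have heq : ∀ y ∈ Ici (0 : ℝ), travelTime n y = ∫ s in (0 : ℝ)..y, n (max s 0) := by
    intro y hy
    refine intervalIntegral.integral_congr fun s hs => ?_
    rw [uIcc_of_le hy] at hs
    simp only [max_eq_left hs.1]
  simpa only [max_eq_left hz] using h.congr heq (heq z hz)

theorem strictMonoOn_travelTime (hn : ContinuousOn n (Ici 0)) (hpos : ∀ z, 0 ≤ z → 0 < n z) :
    StrictMonoOn (travelTime n) (Ici 0) := by
  refine strictMonoOn_of_deriv_pos (convex_Ici 0)
    (fun z hz => (hasDerivWithinAt_travelTime hn hz).continuousWithinAt) fun z hz => ?_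
  rw [interior_Ici] at hz
  rw [((hasDerivWithinAt_travelTime hn (le_of_lt hz)).hasDerivAt (Ici_mem_nhds hz)).deriv]
  exact hpos z (le_of_lt hz)

theorem bijOn_travelTime (hn : ContinuousOn n (Ici 0)) (hpos : ∀ z, 0 ≤ z → 0 < n z)
    (hlim : Tendsto (travelTime n) atTop atTop) : BijOn (travelTime n) (Ici 0) (Ici 0) := by
  have hm := strictMonoOn_travelTime hn hpos
  have h0 : travelTime n 0 = 0 := by simp [travelTime]
  refine ⟨fun z hz => ?_, hm.injOn, fun y hy => ?_⟩
  · rw [mem_Ici, ← h0]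
    exact hm.monotoneOn self_mem_Ici hz hz
  · obtain ⟨Z, hZ, hZ0⟩ := ((hlim.eventually_ge_atTop y).and (eventually_ge_atTop 0)).exists
    have hc : ContinuousOn (travelTime n) (Icc 0 Z) := fun z hz =>
      ((hasDerivWithinAt_travelTime hn hz.1).continuousWithinAt).mono Icc_subset_Ici_self
    obtain ⟨z, hz, hzy⟩ := intermediate_value_Icc hZ0 hc ⟨by rw [h0]; exact hy, hZ⟩
    exact ⟨z, hz.1, hzy⟩

theorem invOn_depth (hn : ContinuousOn n (Ici 0)) (hpos : ∀ z, 0 ≤ z → 0 < n z)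
    (hlim : Tendsto (travelTime n) atTop atTop) :
    InvOn (depth n) (travelTime n) (Ici 0) (Ici 0) :=
  (bijOn_travelTime hn hpos hlim).invOn_invFunOn

theorem mapsTo_depth (hn : ContinuousOn n (Ici 0)) (hpos : ∀ z, 0 ≤ z → 0 < n z)
    (hlim : Tendsto (travelTime n) atTop atTop) : MapsTo (depth n) (Ici 0) (Ici 0) :=
  (bijOn_travelTime hn hpos hlim).surjOn.mapsTo_invFunOn

theorem continuousOn_depth (hn : ContinuousOn n (Ici 0)) (hpos : ∀ z, 0 ≤ z → 0 < n z)
    (hlim : Tendsto (travelTime n) atTop atTop) : ContinuousOn (depth n) (Ici 0) := by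
  have hb := bijOn_travelTime hn hpos hlim
  let e : Ici (0 : ℝ) ≃o Ici (0 : ℝ) := StrictMono.orderIsoOfSurjective
    (hb.mapsTo.restrict (travelTime n) _ _)
    (fun x y h => strictMonoOn_travelTime hn hpos x.2 y.2 h)
    ((hb.mapsTo.restrict_surjective_iff).2 hb.surjOn)
  rw [continuousOn_iff_continuous_domRestrict]
  have h : (Ici (0 : ℝ)).domRestrict (depth n) = fun y => (e.symm y : ℝ) := by
    funext y
    have h1 : travelTime n (e.symm y) = y := congrArg Subtype.val (e.apply_symm_apply y)
    have h2 := (invOn_depth hn hpos hlim).1 (e.symm y).2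
    rw [h1] at h2
    exact h2
  rw [h]
  exact continuous_subtype_val.comp e.symm.continuous

theorem hasDerivWithinAt_depth (hn : ContinuousOn n (Ici 0)) (hpos : ∀ z, 0 ≤ z → 0 < n z)
    (hlim : Tendsto (travelTime n) atTop atTop) {y : ℝ} (hy : 0 ≤ y) :
    HasDerivWithinAt (depth n) (indexTT n y)⁻¹ (Ici 0) y := by
  have hmaps := mapsTo_depth hn hpos hlim
  have hne : n (depth n y) ≠ 0 := (hpos _ (hmaps hy)).ne'
  have h := HasFDerivWithinAt.of_local_left_inverse (f := travelTime n) (g := depth n)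
    (f' := ContinuousLinearEquiv.unitsEquivAut ℝ (Units.mk0 _ hne)) (t := Ici 0) (s := Ici 0)
    (a := y)
    (tendsto_nhdsWithin_of_tendsto_nhds_of_eventually_within _
      (continuousOn_depth hn hpos hlim y hy)
      (eventually_nhdsWithin_of_forall fun z hz => hmaps hz)) ?_ hy
    (eventually_nhdsWithin_of_forall fun z hz => (invOn_depth hn hpos hlim).2 hz)
  · have h' := h.hasDerivWithinAt
    simpa [indexTT] using h'
  · have h' := (hasDerivWithinAt_travelTime hn (hmaps hy)).hasFDerivWithinAt
    have he : ContinuousLinearMap.toSpanSingleton ℝ (n (depth n y))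
        = (ContinuousLinearEquiv.unitsEquivAut ℝ (Units.mk0 _ hne) : ℝ →L[ℝ] ℝ) := by
      ext
      simp
    rwa [he] at h'

theorem contDiffOn_indexTT (hn : ContDiffOn ℝ 2 n (Ici 0)) (hpos : ∀ z, 0 ≤ z → 0 < n z)
    (hlim : Tendsto (travelTime n) atTop atTop) : ContDiffOn ℝ 2 (indexTT n) (Ici 0) := by
  have hmaps := mapsTo_depth hn.continuousOn hpos hlim
  have hd := fun y (hy : 0 ≤ y) => hasDerivWithinAt_depth hn.continuousOn hpos hlim hy
  have hu : UniqueDiffOn ℝ (Ici (0 : ℝ)) := uniqueDiffOn_Ici 0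
  -- each order of smoothness of the depth follows from the previous one, since `z' = 1 / n(z)`
  have step : ∀ k : ℕ, k ≤ 1 → ContDiffOn ℝ k (depth n) (Ici 0) →
      ContDiffOn ℝ (k + 1) (depth n) (Ici 0) := by
    intro k hk h
    rw [contDiffOn_succ_iff_derivWithin hu]
    refine ⟨fun y hy => (hd y hy).differentiableWithinAt, by simp, ?_⟩
    have h1 : ContDiffOn ℝ k (fun y => (n (depth n y))⁻¹) (Ici 0) :=
      ((hn.of_le (by exact_mod_cast hk.trans one_le_two)).comp h hmaps).inv
        fun y hy => (hpos _ (hmaps hy)).ne'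
    exact h1.congr fun y hy => (hd y hy).derivWithin (hu y hy)
  have h0 : ContDiffOn ℝ (0 : ℕ) (depth n) (Ici 0) :=
    contDiffOn_zero.2 (continuousOn_depth hn.continuousOn hpos hlim)
  have h1 := step 0 zero_le_one h0
  have h2 := step 1 le_rfl (by simpa using h1)
  exact hn.comp (by simpa [one_add_one_eq_two] using h2) hmaps

theorem indexTT_pos (hn : ContinuousOn n (Ici 0)) (hpos : ∀ z, 0 ≤ z → 0 < n z)
    (hlim : Tendsto (travelTime n) atTop atTop) {y : ℝ} (hy : 0 ≤ y) : 0 < indexTT n y :=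
  hpos _ (mapsTo_depth hn hpos hlim hy)

end TravelTime

/-! ### The Liouville substitution -/

section Liouville

variable {n : ℝ → ℝ} {ρ : ℝ} {ξ : EuclideanSpace ℝ (Fin 2)} {U : ℝ → TimeDistribution}

theorem contDiffOn_sqrt_admittance (hN : ContDiffOn ℝ 2 (indexTT n) (Ici 0)) (hρ : 0 < ρ)
    (hpos : ∀ y, 0 ≤ y → 0 < indexTT n y) :
    ContDiffOn ℝ 2 (fun y => √(admittance n ρ y)) (Ici 0) :=
  (hN.div_const ρ).sqrt fun y hy => (div_pos (hpos y hy) hρ).ne'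

theorem continuousOn_potential (hN : ContDiffOn ℝ 2 (indexTT n) (Ici 0)) (hρ : 0 < ρ)
    (hpos : ∀ y, 0 ≤ y → 0 < indexTT n y) : ContinuousOn (potential n ρ ξ) (Ici 0) := by
  have hS := contDiffOn_sqrt_admittance hN hρ hpos
  refine ((hS.continuousOn_iteratedDerivWithin le_rfl (uniqueDiffOn_Ici 0)).neg.div
    hS.continuousOn fun y hy => ?_).sub
      (continuousOn_const.div (hN.continuousOn.pow 2) fun y hy => ?_)
  · exact (Real.sqrt_pos.2 (div_pos (hpos y hy) hρ)).ne'
  · exact pow_ne_zero 2 (hpos y hy).ne'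

theorem hasDerivWithinAt_psiOne (hN : ContDiffOn ℝ 2 (indexTT n) (Ici 0)) (hρ : 0 < ρ)
    (hpos : ∀ y, 0 ≤ y → 0 < indexTT n y) (hU : IsZeroOrderSolution n ρ ξ U) {y : ℝ}
    (hy : 0 ≤ y) :
    HasDerivWithinAt (psiOne n ρ U) (derivWithin (fun y => √(admittance n ρ y)) (Ici 0) y • U y
      + √(admittance n ρ y) • dy U y) (Ici 0) y :=
  (((contDiffOn_sqrt_admittance hN hρ hpos).differentiableOn two_ne_zero y
    hy).hasDerivWithinAt).smul_tvs (hU.differentiable y hy).hasDerivWithinAt_tvs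

theorem dy_psiOne (hN : ContDiffOn ℝ 2 (indexTT n) (Ici 0)) (hρ : 0 < ρ)
    (hpos : ∀ y, 0 ≤ y → 0 < indexTT n y) (hU : IsZeroOrderSolution n ρ ξ U) {y : ℝ}
    (hy : 0 ≤ y) :
    dy (psiOne n ρ U) y = derivWithin (fun y => √(admittance n ρ y)) (Ici 0) y • U y
      + √(admittance n ρ y) • dy U y :=
  have := neBot_nhdsWithin_Ici_diff hy
  (hasDerivWithinAt_psiOne hN hρ hpos hU hy).derivWithin_tvs

/-- The equation `W_y = V - ∂ₜ W` for `W = √σ U`, `V = ∂ₜ W + W_y`. -/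
theorem hasDerivWithinAt_psiOne' (hN : ContDiffOn ℝ 2 (indexTT n) (Ici 0)) (hρ : 0 < ρ)
    (hpos : ∀ y, 0 ≤ y → 0 < indexTT n y) (hU : IsZeroOrderSolution n ρ ξ U) {y : ℝ}
    (hy : 0 ≤ y) :
    HasDerivWithinAt (psiOne n ρ U) (psiTwo n ρ U y - ∂_{(1 : ℝ)} (psiOne n ρ U y)) (Ici 0) y := by
  have h := hasDerivWithinAt_psiOne hN hρ hpos hU hy
  rw [← dy_psiOne hN hρ hpos hU hy] at h
  rwa [psiTwo, add_sub_cancel_left]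

/-- The equation `V_y = ∂ₜ V - q W`, or `W_tt = W_yy + q W`, the wave equation in terms of `W = √σ U`. -/
theorem hasDerivWithinAt_psiTwo (hN : ContDiffOn ℝ 2 (indexTT n) (Ici 0)) (hρ : 0 < ρ)
    (hpos : ∀ y, 0 ≤ y → 0 < indexTT n y) (hU : IsZeroOrderSolution n ρ ξ U) {y : ℝ}
    (hy : 0 ≤ y) :
    HasDerivWithinAt (psiTwo n ρ U)
      (∂_{(1 : ℝ)} (psiTwo n ρ U y) - potential n ρ ξ y • psiOne n ρ U y) (Ici 0) y := by
  have hS2 := contDiffOn_sqrt_admittance hN hρ hpos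
  have hu : UniqueDiffOn ℝ (Ici (0 : ℝ)) := uniqueDiffOn_Ici 0
  have hσ : ∀ y, 0 ≤ y → √(admittance n ρ y) ^ 2 = admittance n ρ y := fun y hy =>
    Real.sq_sqrt (div_pos (hpos y hy) hρ).le
  have hS0 : ∀ y, 0 ≤ y → √(admittance n ρ y) ≠ 0 := fun y hy =>
    (Real.sqrt_pos.2 (div_pos (hpos y hy) hρ)).ne'
  have hq : potential n ρ ξ y
      = -(derivWithin (derivWithin (fun y => √(admittance n ρ y)) (Ici 0)) (Ici 0) y)
        / √(admittance n ρ y) - ‖ξ‖ ^ 2 / indexTT n y ^ 2 := by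
    rw [potential, iteratedDerivWithin_succ, iteratedDerivWithin_one]
  have hS : HasDerivWithinAt (fun y => √(admittance n ρ y))
      (derivWithin (fun y => √(admittance n ρ y)) (Ici 0) y) (Ici 0) y :=
    (hS2.differentiableOn two_ne_zero y hy).hasDerivWithinAt
  have hS' : HasDerivWithinAt (derivWithin (fun y => √(admittance n ρ y)) (Ici 0))
      (derivWithin (derivWithin (fun y => √(admittance n ρ y)) (Ici 0)) (Ici 0) y) (Ici 0) y := by
    have h2 := ((contDiffOn_succ_iff_derivWithin (n := 1) hu).1
      (by simpa [one_add_one_eq_two] using hS2)).2.2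
    exact (h2.differentiableOn one_ne_zero y hy).hasDerivWithinAt
  have hP := (hU.differentiable_flux y hy).hasDerivWithinAt_tvs
  have hUd := (hU.differentiable y hy).hasDerivWithinAt_tvs
  have hwave := hU.wave y hy
  have hdyP : derivWithin (fun y => admittance n ρ y • dy U y) (Ici 0) y
      = admittance n ρ y • (∂_{(1 : ℝ)} (∂_{(1 : ℝ)} (U y)))
        + (admittance n ρ y * (‖ξ‖ ^ 2 / indexTT n y ^ 2)) • U y := by
    change dy (fun y => admittance n ρ y • dy U y) y = _
    have h0 : admittance n ρ y ≠ 0 := (div_pos (hpos y hy) hρ).ne'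
    have h1 : (1 / admittance n ρ y) • dy (fun η => admittance n ρ η • dy U η) y
        = ∂_{(1 : ℝ)} (∂_{(1 : ℝ)} (U y)) + (‖ξ‖ ^ 2 / indexTT n y ^ 2) • U y := by
      rw [← sub_eq_zero, ← neg_eq_zero, ← hwave]; abel
    rw [mul_smul, ← smul_add, ← h1, smul_smul, mul_one_div_cancel h0, one_smul]
  -- `W_y = (√σ)' U + (√σ)⁻¹ (σ U_y)`, so that only `U` and the flux `σ U_y` are differentiated
  have hWy : HasDerivWithinAt (dy (psiOne n ρ U))
      (∂_{(1 : ℝ)} (∂_{(1 : ℝ)} (psiOne n ρ U y)) - potential n ρ ξ y • psiOne n ρ U y)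
      (Ici 0) y := by
    have h := (hS'.smul_tvs hUd).add_tvs ((hS.inv (hS0 y hy)).smul_tvs hP)
    have h' := h.congr_tvs (g := dy (psiOne n ρ U)) (fun z hz => ?_) hy
    · convert h' using 1
      change _ = _ + _ • dy U y + _
      have e1 : (∂_{(1 : ℝ)} (∂_{(1 : ℝ)} (√(admittance n ρ y) • U y)) : TimeDistribution)
          = √(admittance n ρ y) • ∂_{(1 : ℝ)} (∂_{(1 : ℝ)} (U y)) := by
        rw [LineDeriv.lineDerivOp_smul, LineDeriv.lineDerivOp_smul]
      have h0 := hS0 y hy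
      have hσy := hσ y hy
      rw [hdyP, hq, psiOne, e1]
      simp only [Pi.inv_apply]
      generalize √(admittance n ρ y) = s at h0 hσy ⊢
      rw [← hσy]
      match_scalars <;> field_simp <;> ring
    · rw [dy_psiOne hN hρ hpos hU hz]
      simp only [Pi.inv_apply]
      rw [smul_smul]
      congr 2
      have h0 := hS0 z hz
      rw [eq_inv_mul_iff_mul_eq₀ h0, ← sq, hσ z hz]
  have h := ((hasDerivWithinAt_psiOne' hN hρ hpos hU hy).clm_apply_tvs
    (Distribution.lineDerivCLM (1 : ℝ))).add_tvs hWy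
  have e : (∂_{(1 : ℝ)} (psiTwo n ρ U y) - potential n ρ ξ y • psiOne n ρ U y : TimeDistribution)
      = ∂_{(1 : ℝ)} (psiTwo n ρ U y - ∂_{(1 : ℝ)} (psiOne n ρ U y))
        + (∂_{(1 : ℝ)} (∂_{(1 : ℝ)} (psiOne n ρ U y))
          - potential n ρ ξ y • psiOne n ρ U y) := by
    rw [sub_eq_add_neg (psiTwo n ρ U y), LineDeriv.lineDerivOp_add, LineDeriv.lineDerivOp_neg]
    abel
  rw [e]
  exact h

theorem sqrt_admittance_mul_sqrt {n : ℝ → ℝ} {ρ : ℝ} (hρ : 0 < ρ) (h0 : 0 < indexTT n 0) :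
    √(admittance n ρ 0) * √(ρ / indexTT n 0) = 1 := by
  rw [admittance, ← Real.sqrt_mul (div_pos h0 hρ).le, div_mul_div_cancel₀ hρ.ne',
    div_self h0.ne', Real.sqrt_one]

theorem psiOne_zero (hρ : 0 < ρ) (hpos : 0 < indexTT n 0) (hU : IsZeroOrderSolution n ρ ξ U) :
    psiOne n ρ U 0 = Distribution.delta (0 : ℝ) := by
  rw [psiOne, hU.boundary, smul_smul, sqrt_admittance_mul_sqrt hρ hpos, one_smul]

/-- The datum `g` is the boundary value of `V = ∂ₜ W + W_y`. -/
theorem psiTwo_zero (hN : ContDiffOn ℝ 2 (indexTT n) (Ici 0)) (hρ : 0 < ρ)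
    (hpos : ∀ y, 0 ≤ y → 0 < indexTT n y) (hU : IsZeroOrderSolution n ρ ξ U) :
    psiTwo n ρ U 0 = dataG n ρ (response n U) := by
  have h0 := hpos 0 le_rfl
  have hsq := sqrt_admittance_mul_sqrt hρ h0
  have hder : derivWithin (fun y => √(admittance n ρ y)) (Ici 0) 0
      = derivWithin (indexTT n) (Ici 0) 0 / ρ / (2 * √(admittance n ρ 0)) := by
    have h1 := ((hN.differentiableOn two_ne_zero 0 self_mem_Ici).hasDerivWithinAt.div_const
      ρ).sqrt (div_pos h0 hρ).ne'
    exact h1.derivWithin (uniqueDiffOn_Ici 0 0 self_mem_Ici)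
  have hS0 : √(admittance n ρ 0) ≠ 0 := (Real.sqrt_pos.2 (div_pos h0 hρ)).ne'
  have hσ : √(admittance n ρ 0) ^ 2 = indexTT n 0 / ρ := Real.sq_sqrt (div_pos h0 hρ).le
  have hc : derivWithin (fun y => √(admittance n ρ y)) (Ici 0) 0 * √(ρ / indexTT n 0)
      = derivWithin (indexTT n) (Ici 0) 0 / (2 * indexTT n 0) := by
    have e : √(ρ / indexTT n 0) = 1 / √(admittance n ρ 0) := by
      rw [eq_div_iff hS0, mul_comm, hsq]
    rw [hder, e]
    have : indexTT n 0 = ρ * √(admittance n ρ 0) ^ 2 := by rw [hσ]; field_simp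
    rw [this]; field_simp
  have hr : √(admittance n ρ 0) = 1 / √(ρ * indexTT n 0) * indexTT n 0 := by
    rw [admittance, Real.sqrt_div h0.le, Real.sqrt_mul hρ.le]
    have hs : √(indexTT n 0) ≠ 0 := (Real.sqrt_pos.2 h0).ne'
    have hs' : √ρ ≠ 0 := (Real.sqrt_pos.2 hρ).ne'
    field_simp
    exact Real.sq_sqrt h0.le
  rw [psiTwo, psiOne_zero hρ h0 hU, dy_psiOne hN hρ hpos hU le_rfl, dataG, response, hU.boundary,
    smul_smul, hc, smul_smul, ← hr, add_assoc]

end Liouville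

/-! ### The Goursat problem on the sector `0 ≤ y ≤ t` -/

theorem continuous_intervalIntegral_of_continuous {X : Type*} [TopologicalSpace X]
    {f : X → ℝ → ℝ} {a b : X → ℝ} (hf : Continuous (Function.uncurry f)) (ha : Continuous a)
    (hb : Continuous b) : Continuous fun x => ∫ s in a x..b x, f x s := by
  have h : (fun x => ∫ s in a x..b x, f x s)
      = fun x => (∫ s in (0 : ℝ)..b x, f x s) - ∫ s in (0 : ℝ)..a x, f x s := by
    funext x
    have hx : Continuous (f x) := hf.comp (Continuous.prodMk_right x)
    rw [intervalIntegral.integral_interval_sub_left (hx.intervalIntegrable _ _)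
      (hx.intervalIntegrable _ _)]
  rw [h]
  exact (intervalIntegral.continuous_parametric_intervalIntegral_of_continuous hf hb).sub
    (intervalIntegral.continuous_parametric_intervalIntegral_of_continuous hf ha)

section Goursat

variable (Q : ℝ → ℝ)

/-- The integral `∫ Q(s) f(s, t + y - s) ds` over the part of the characteristic
`s + τ = t + y` that runs from `(y, t)` to the diagonal `s = τ`. -/
def backwardIntegral (f : ℝ × ℝ → ℝ) (p : ℝ × ℝ) : ℝ :=
  ∫ s in p.1..(p.2 + p.1) / 2, Q s * f (s, p.2 + p.1 - s)

/-- The integral `∫ f(η, t + η - y) dη` over the characteristic `τ - η = t - y` from the boundary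
`η = 0` to the point `(y, t)`. -/
def forwardIntegral (f : ℝ × ℝ → ℝ) (p : ℝ × ℝ) : ℝ :=
  ∫ η in (0 : ℝ)..p.1, f (η, p.2 + η - p.1)

/-- The rate `|Q(u / 2)| + ∫₀^{u/2} |Q|` at which the weight `goursatWeight` grows. -/
def goursatRate (u : ℝ) : ℝ := |Q (u / 2)| + ∫ s in (0 : ℝ)..u / 2, |Q s|

/-- A weight in `u = t + y` for which the Goursat integral operator is a contraction, however fast
`Q` grows. -/
def goursatWeight (u : ℝ) : ℝ := Real.exp (∫ r in (0 : ℝ)..u, goursatRate Q r)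

variable {Q}

theorem continuous_backwardIntegral (hQ : Continuous Q) {f : ℝ × ℝ → ℝ} (hf : Continuous f) :
    Continuous (backwardIntegral Q f) := by
  refine continuous_intervalIntegral_of_continuous ?_ continuous_fst (by fun_prop)
  simp only [Function.uncurry_def]
  fun_prop

theorem continuous_forwardIntegral {f : ℝ × ℝ → ℝ} (hf : Continuous f) :
    Continuous (forwardIntegral f) := by
  refine continuous_intervalIntegral_of_continuous ?_ continuous_const continuous_fst
  simp only [Function.uncurry_def]
  fun_prop

theorem continuous_goursatRate (hQ : Continuous Q) : Continuous (goursatRate Q) := by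
  refine Continuous.add (by fun_prop) ?_
  exact continuous_intervalIntegral_of_continuous (f := fun _ s => |Q s|)
    (by simp only [Function.uncurry_def]; fun_prop) continuous_const (by fun_prop)

theorem hasDerivAt_goursatWeight (hQ : Continuous Q) (u : ℝ) :
    HasDerivAt (goursatWeight Q) (goursatRate Q u * goursatWeight Q u) u := by
  have h := ((continuous_goursatRate hQ).integral_hasStrictDerivAt 0 u).hasDerivAt.exp
  rwa [mul_comm] at h

theorem continuous_goursatWeight (hQ : Continuous Q) : Continuous (goursatWeight Q) :=
  continuous_iff_continuousAt.2 fun u => (hasDerivAt_goursatWeight hQ u).continuousAt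

theorem goursatWeight_pos (u : ℝ) : 0 < goursatWeight Q u := Real.exp_pos _

theorem abs_le_goursatRate {u : ℝ} (hu : 0 ≤ u) : |Q (u / 2)| ≤ goursatRate Q u :=
  le_add_of_nonneg_right
    (intervalIntegral.integral_nonneg (by linarith) fun _ _ => abs_nonneg _)

theorem one_le_goursatWeight {u : ℝ} (hu : 0 ≤ u) : 1 ≤ goursatWeight Q u := by
  refine Real.one_le_exp (intervalIntegral.integral_nonneg hu fun r hr => ?_)
  exact (abs_nonneg _).trans (abs_le_goursatRate hr.1)

/-- The backward integral costs a factor `goursatRate`: the weight is constant on its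
characteristic. -/
theorem abs_backwardIntegral_le (hQ : Continuous Q) {f : ℝ × ℝ → ℝ} {C : ℝ}
    (hC : 0 ≤ C) (hfC : ∀ y t, 0 ≤ y → y ≤ t → |f (y, t)| ≤ C * goursatWeight Q (t + y))
    {y t : ℝ} (hy : 0 ≤ y) (hyt : y ≤ t) :
    |backwardIntegral Q f (y, t)| ≤ C * (goursatRate Q (t + y) * goursatWeight Q (t + y)) := by
  have hE := goursatWeight_pos (Q := Q) (t + y)
  have h1 : |backwardIntegral Q f (y, t)|
      ≤ ∫ s in y..(t + y) / 2, |Q s| * (C * goursatWeight Q (t + y)) := by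
    rw [← Real.norm_eq_abs]
    refine intervalIntegral.norm_integral_le_of_norm_le (by linarith) (ae_of_all _ fun s hs => ?_)
      (Continuous.intervalIntegrable (by fun_prop) _ _)
    rw [norm_mul, Real.norm_eq_abs, Real.norm_eq_abs]
    gcongr
    have := hfC s (t + y - s) (hy.trans hs.1.le) (by linarith [hs.2])
    rwa [sub_add_cancel] at this
  refine h1.trans ?_
  rw [intervalIntegral.integral_mul_const]
  have h2 : ∫ s in y..(t + y) / 2, |Q s| ≤ ∫ s in (0 : ℝ)..(t + y) / 2, |Q s| :=
    intervalIntegral.integral_mono_interval hy (by linarith) le_rfl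
      (ae_of_all _ fun _ => abs_nonneg _) (hQ.abs.intervalIntegrable _ _)
  have h3 : ∫ s in (0 : ℝ)..(t + y) / 2, |Q s| ≤ goursatRate Q (t + y) :=
    le_add_of_nonneg_left (abs_nonneg _)
  calc (∫ s in y..(t + y) / 2, |Q s|) * (C * goursatWeight Q (t + y))
      ≤ goursatRate Q (t + y) * (C * goursatWeight Q (t + y)) := by gcongr; exact h2.trans h3
    _ = _ := by ring

/-- The forward integral gains back the factor `goursatRate`, and a half, since `t + y` runs at
double speed along its characteristic. -/
theorem abs_forwardIntegral_le (hQ : Continuous Q) {f : ℝ × ℝ → ℝ} {C : ℝ}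
    (hC : 0 ≤ C) (hfC : ∀ y t, 0 ≤ y → y ≤ t →
      |f (y, t)| ≤ C * (goursatRate Q (t + y) * goursatWeight Q (t + y)))
    {y t : ℝ} (hy : 0 ≤ y) (hyt : y ≤ t) :
    |forwardIntegral f (y, t)| ≤ C / 2 * goursatWeight Q (t + y) := by
  have hcR := continuous_goursatRate hQ
  have hcW := continuous_goursatWeight hQ
  have h1 : |forwardIntegral f (y, t)| ≤ ∫ η in (0 : ℝ)..y,
      C * (goursatRate Q (t - y + 2 * η) * goursatWeight Q (t - y + 2 * η)) := by
    rw [← Real.norm_eq_abs]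
    refine intervalIntegral.norm_integral_le_of_norm_le hy (ae_of_all _ fun η hη => ?_)
      (Continuous.intervalIntegrable (by fun_prop) _ _)
    have := hfC η (t + η - y) hη.1.le (by linarith)
    rwa [show t + η - y + η = t - y + 2 * η by ring] at this
  have h2 : ∫ η in (0 : ℝ)..y, goursatRate Q (t - y + 2 * η) * goursatWeight Q (t - y + 2 * η)
      = goursatWeight Q (t + y) / 2 - goursatWeight Q (t - y) / 2 := by
    have hd : ∀ η, HasDerivAt (fun η => goursatWeight Q (t - y + 2 * η) / 2)
        (goursatRate Q (t - y + 2 * η) * goursatWeight Q (t - y + 2 * η)) η := fun η => by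
      have h3 : HasDerivAt (fun η : ℝ => t - y + 2 * η) 2 η := by
        simpa using ((hasDerivAt_id η).const_mul 2).const_add (t - y)
      have h4 := ((hasDerivAt_goursatWeight hQ (t - y + 2 * η)).comp η h3).div_const 2
      rwa [mul_div_cancel_right₀ _ two_ne_zero] at h4
    rw [intervalIntegral.integral_eq_sub_of_hasDerivAt (fun η _ => hd η)
      (Continuous.intervalIntegrable (by fun_prop) _ _)]
    congr 3 <;> ring
  refine h1.trans ?_
  rw [intervalIntegral.integral_const_mul, h2]
  nlinarith [goursatWeight_pos (Q := Q) (t - y),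
    mul_nonneg hC (goursatWeight_pos (Q := Q) (t - y)).le]

theorem backwardIntegral_sub (hQ : Continuous Q) {f g : ℝ × ℝ → ℝ} (hf : Continuous f)
    (hg : Continuous g) (p : ℝ × ℝ) : backwardIntegral Q f p - backwardIntegral Q g p
      = backwardIntegral Q (fun p => f p - g p) p := by
  simp only [backwardIntegral]
  rw [← intervalIntegral.integral_sub (Continuous.intervalIntegrable (by fun_prop) _ _)
    (Continuous.intervalIntegrable (by fun_prop) _ _)]
  simp only [mul_sub]

theorem forwardIntegral_sub {f g : ℝ × ℝ → ℝ} (hf : Continuous f)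
    (hg : Continuous g) (p : ℝ × ℝ) : forwardIntegral f p - forwardIntegral g p
      = forwardIntegral (fun p => f p - g p) p := by
  simp only [forwardIntegral]
  rw [← intervalIntegral.integral_sub (Continuous.intervalIntegrable (by fun_prop) _ _)
    (Continuous.intervalIntegrable (by fun_prop) _ _)]

/-- A retraction of the plane onto the sector `0 ≤ y ≤ t`. -/
def sectorRetract (p : ℝ × ℝ) : ℝ × ℝ := (max p.1 0, max p.2 (max p.1 0))

theorem continuous_sectorRetract : Continuous sectorRetract := by
  unfold sectorRetract; fun_prop

theorem sectorRetract_of_mem {y t : ℝ} (hy : 0 ≤ y) (hyt : y ≤ t) :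
    sectorRetract (y, t) = (y, t) := by
  simp [sectorRetract, hy, hyt]

/-- The Goursat problem has a continuous solution. The functions live on the whole plane, where `Ψ₁`
is the continuous extension by a retraction onto the sector and only the equation for `Ψ₂` holds
everywhere. -/
theorem exists_goursat_solution (hQ : Continuous Q) : ∃ Ψ₁ Ψ₂ : ℝ × ℝ → ℝ,
    Continuous Ψ₁ ∧ Continuous Ψ₂ ∧
    (∀ p, Ψ₂ p = Q ((p.2 + p.1) / 2) / 2 + backwardIntegral Q Ψ₁ p) ∧
    ∀ y t, 0 ≤ y → y ≤ t → Ψ₁ (y, t) = forwardIntegral Ψ₂ (y, t) := by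
  have hcW := continuous_goursatWeight hQ
  -- the unknown is `h = Ψ₁ / weight`, a bounded function on the sector pulled back to the plane
  let ω : ℝ × ℝ → ℝ := fun p => goursatWeight Q ((sectorRetract p).2 + (sectorRetract p).1)
  have hω : Continuous ω :=
    hcW.comp ((continuous_snd.add continuous_fst).comp continuous_sectorRetract)
  have hωpos : ∀ p, 0 < ω p := fun p => goursatWeight_pos _
  have hωD : ∀ y t, 0 ≤ y → y ≤ t → ω (y, t) = goursatWeight Q (t + y) := fun y t hy hyt => by
    simp only [ω, sectorRetract_of_mem hy hyt]
  let N : (ℝ × ℝ → ℝ) → ℝ × ℝ → ℝ := fun f p =>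
    Q ((p.2 + p.1) / 2) / 2 + backwardIntegral Q f p
  have hN : ∀ {f}, Continuous f → Continuous (N f) := fun hf =>
    Continuous.add (by fun_prop) (continuous_backwardIntegral hQ hf)
  have hret : ∀ p, 0 ≤ (sectorRetract p).1 ∧ (sectorRetract p).1 ≤ (sectorRetract p).2 :=
    fun p => ⟨le_max_right _ _, le_max_right _ _⟩
  have hNbd : ∀ (f : ℝ × ℝ → ℝ) (C : ℝ), 0 ≤ C → (∀ p, |f p| ≤ C * ω p) → ∀ p,
      |forwardIntegral (N f) (sectorRetract p)| ≤ (1 + C) / 2 * ω p := by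
    intro f C hC hf p
    refine abs_forwardIntegral_le hQ (by positivity) (fun y t hy hyt => ?_) (hret p).1 (hret p).2
    have h1 := abs_backwardIntegral_le hQ hC (f := f)
      (fun y t hy hyt => by rw [← hωD y t hy hyt]; exact hf _) hy hyt
    have hu : 0 ≤ t + y := by linarith
    have h2 : |Q ((t + y) / 2) / 2| ≤ goursatRate Q (t + y) * goursatWeight Q (t + y) := by
      have h3 := abs_le_goursatRate (Q := Q) hu
      have h4 := one_le_goursatWeight (Q := Q) hu
      rw [abs_div, abs_two]
      nlinarith [abs_nonneg (Q ((t + y) / 2))]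
    rw [add_mul, one_mul]
    exact (abs_add_le _ _).trans (add_le_add h2 h1)
  let X := BoundedContinuousFunction (ℝ × ℝ) ℝ
  have hfc : ∀ h : X, Continuous fun p => ω p * h p := fun h => hω.mul h.continuous
  have hfb : ∀ h : X, ∀ p, |ω p * h p| ≤ ‖h‖ * ω p := fun h p => by
    rw [abs_mul, abs_of_pos (hωpos p), mul_comm]
    exact mul_le_mul_of_nonneg_right (h.norm_coe_le_norm p) (hωpos p).le
  let Φ : X → X := fun h => BoundedContinuousFunction.ofNormedAddCommGroup
    (fun p => (ω p)⁻¹ * forwardIntegral (N fun p => ω p * h p) (sectorRetract p))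
    ((hω.inv₀ fun p => (hωpos p).ne').mul
      ((continuous_forwardIntegral (hN (hfc h))).comp continuous_sectorRetract))
    ((1 + ‖h‖) / 2) (fun p => by
      rw [norm_mul, norm_inv, Real.norm_eq_abs, Real.norm_eq_abs, abs_of_pos (hωpos p),
        inv_mul_le_iff₀ (hωpos p), mul_comm]
      exact hNbd _ _ (norm_nonneg h) (hfb h) p)
  have hΦ : ContractingWith (1 / 2) Φ := by
    refine ⟨by norm_num, LipschitzWith.of_dist_le_mul fun h k => ?_⟩
    rw [BoundedContinuousFunction.dist_le (by positivity)]
    intro p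
    rw [Real.dist_eq]
    change |(ω p)⁻¹ * forwardIntegral (N fun p => ω p * h p) (sectorRetract p)
      - (ω p)⁻¹ * forwardIntegral (N fun p => ω p * k p) (sectorRetract p)| ≤ _
    rw [← mul_sub, abs_mul, abs_inv, abs_of_pos (hωpos p), inv_mul_le_iff₀ (hωpos p),
      forwardIntegral_sub (hN (hfc h)) (hN (hfc k))]
    have h1 : (fun p => N (fun p => ω p * h p) p - N (fun p => ω p * k p) p)
        = backwardIntegral Q fun p => ω p * (h - k) p := by
      funext p
      simp only [N, add_sub_add_left_eq_sub]
      rw [backwardIntegral_sub hQ (hfc h) (hfc k)]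
      have h2 : ∀ p, (h - k) p = h p - k p := fun _ => rfl
      simp only [h2, mul_sub]
    rw [h1, dist_eq_norm]
    have h2 := abs_forwardIntegral_le hQ (norm_nonneg (h - k))
      (f := backwardIntegral Q fun p => ω p * (h - k) p)
      (fun y t hy hyt => abs_backwardIntegral_le hQ (norm_nonneg (h - k))
        (fun y t hy hyt => by rw [← hωD y t hy hyt]; exact hfb (h - k) _) hy hyt)
      (hret p).1 (hret p).2
    refine h2.trans (le_of_eq ?_)
    simp only [ω, NNReal.coe_div, NNReal.coe_one, NNReal.coe_ofNat]
    ring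
  obtain ⟨h, hh⟩ : ∃ h, Φ h = h := ⟨_, hΦ.fixedPoint_isFixedPt⟩
  refine ⟨fun p => ω p * h p, N fun p => ω p * h p, hfc h, hN (hfc h), fun p => rfl,
    fun y t hy hyt => ?_⟩
  have h1 : (ω (y, t))⁻¹ * forwardIntegral (N fun p => ω p * h p) (sectorRetract (y, t))
      = h (y, t) := congrArg (fun h : X => h (y, t)) hh
  rw [sectorRetract_of_mem hy hyt] at h1
  change ω (y, t) * h (y, t) = _
  rw [← h1, mul_inv_cancel_left₀ (hωpos _).ne']

end Goursat

/-! ### The Goursat solution as a solution in the sense of distributions -/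

/-- Fubini on the triangle `a ≤ s ≤ r ≤ b`. -/
theorem integral_triangle_swap {G : ℝ → ℝ → ℝ} (hG : Continuous (Function.uncurry G)) {a b : ℝ}
    (hab : a ≤ b) :
    ∫ s in a..b, ∫ r in s..b, G s r = ∫ r in a..b, ∫ s in a..r, G s r := by
  have hT : MeasurableSet {p : ℝ × ℝ | p.1 < p.2} := measurableSet_lt measurable_fst measurable_snd
  have hint : Integrable (Function.uncurry fun s r => {p : ℝ × ℝ | p.1 < p.2}.indicator
      (Function.uncurry G) (s, r)) ((volume.restrict (Ioc a b)).prod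
        (volume.restrict (Ioc a b))) := by
    refine Integrable.indicator (f := Function.uncurry G) ?_ hT
    rw [Measure.prod_restrict]
    exact (hG.continuousOn.integrableOn_compact (isCompact_Icc.prod isCompact_Icc)).mono_set
      (prod_mono Ioc_subset_Icc_self Ioc_subset_Icc_self)
  have hswap := integral_integral_swap hint
  rw [intervalIntegral.integral_of_le hab, intervalIntegral.integral_of_le hab]
  convert hswap using 1
  · refine setIntegral_congr_fun measurableSet_Ioc fun s hs => ?_
    have e : (fun r => {p : ℝ × ℝ | p.1 < p.2}.indicator (Function.uncurry G) (s, r))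
        = (Ioi s).indicator (G s) := by
      funext r; simp [indicator]
    simp only [e]
    rw [setIntegral_indicator measurableSet_Ioi, intervalIntegral.integral_of_le hs.2]
    congr 2
    ext r; simp only [mem_Ioc, mem_inter_iff, mem_Ioi]
    exact ⟨fun h => ⟨⟨hs.1.trans h.1, h.2⟩, h.1⟩, fun h => ⟨h.2, h.1.2⟩⟩
  · refine setIntegral_congr_fun measurableSet_Ioc fun r hr => ?_
    have e : (fun s => {p : ℝ × ℝ | p.1 < p.2}.indicator (Function.uncurry G) (s, r))
        = (Iio r).indicator fun s => G s r := by
      funext s; simp [indicator]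
    simp only [e]
    rw [setIntegral_indicator measurableSet_Iio, intervalIntegral.integral_of_le hr.1.le,
      integral_Ioc_eq_integral_Ioo]
    congr 2
    ext s; simp only [mem_Ioo, mem_Ioc, mem_inter_iff, mem_Iio]
    exact ⟨fun h => ⟨⟨h.1, h.2.le.trans hr.2⟩, h.2⟩, fun h => ⟨h.1.1, h.2⟩⟩

theorem integral_eq_integral_of_eq_zero_ge {f : ℝ → ℝ} (hf : Continuous f) {L : ℝ}
    (h0 : ∀ t, L ≤ t → f t = 0) {a c d : ℝ} (hc : L ≤ c) (hd : L ≤ d) :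
    ∫ t in a..c, f t = ∫ t in a..d, f t := by
  have h : ∫ t in d..c, f t = 0 := intervalIntegral.integral_zero_ae <|
    ae_of_all _ fun t ht => h0 t ((le_min hd hc).trans (le_of_lt ht.1))
  rw [← intervalIntegral.integral_add_adjacent_intervals (hf.intervalIntegrable a d)
    (hf.intervalIntegrable d c), h, add_zero]

section Representation

variable {Q φ : ℝ → ℝ} {Ψ₁ Ψ₂ : ℝ × ℝ → ℝ} {M R L : ℝ}

/-- The functions `θ(t - y) Ψ₁` and `θ(t - y) Ψ₂` satisfy the forward characteristic identity
against the translate of `φ` by `a`. The condition on `L` puts the supports of the translates below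
`L`. -/
theorem integral_forward_representation (hΨ₂ : Continuous Ψ₂) (hφ : Continuous φ)
    (hfwd : ∀ y t, 0 ≤ y → y ≤ t → Ψ₁ (y, t) = forwardIntegral Ψ₂ (y, t))
    (hM : ∀ x, M ≤ |x| → φ x = 0) (hL : R + M ≤ L) {y a : ℝ} (hy : 0 ≤ y)
    (hyL : y ≤ L) (hR : y + a ≤ R) :
    ∫ η in (0 : ℝ)..y, ∫ t in η..L, Ψ₂ (η, t) * φ (t - (a + η - y))
      = ∫ t in y..L, Ψ₁ (y, t) * φ (t - a) := by
  have hz : ∀ t, L ≤ t → φ (t - a) = 0 := fun t ht =>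
    hM _ (le_trans (by linarith) (le_abs_self _))
  calc ∫ η in (0 : ℝ)..y, ∫ t in η..L, Ψ₂ (η, t) * φ (t - (a + η - y))
      = ∫ η in (0 : ℝ)..y, ∫ t in y..L, Ψ₂ (η, t + η - y) * φ (t - a) := by
        refine intervalIntegral.integral_congr fun η hη => ?_
        rw [uIcc_of_le hy] at hη
        have h1 := intervalIntegral.integral_comp_add_right (a := y) (b := L + (y - η))
          (fun t => Ψ₂ (η, t) * φ (t - (a + η - y))) (η - y)
        rw [add_sub_cancel, show L + (y - η) + (η - y) = L by ring] at h1
        rw [← h1, integral_eq_integral_of_eq_zero_ge (L := L) (d := L) (by fun_prop) _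
          (by linarith [hη.2]) le_rfl]
        · refine intervalIntegral.integral_congr fun t _ => ?_
          congr 2
          · rw [add_sub_assoc]
          · ring
        · intro t ht
          rw [show t + (η - y) - (a + η - y) = t - a by ring, hz t ht, mul_zero]
    _ = ∫ t in y..L, ∫ η in (0 : ℝ)..y, Ψ₂ (η, t + η - y) * φ (t - a) := by
        refine intervalIntegral_intervalIntegral_swap ?_
        have hcont : Continuous (Function.uncurry fun η t => Ψ₂ (η, t + η - y) * φ (t - a)) := by
          simp only [Function.uncurry_def]; fun_prop
        exact (hcont.continuousOn.integrableOn_compact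
          (isCompact_uIcc.prod isCompact_uIcc)).mono_set
            (prod_mono uIoc_subset_uIcc uIoc_subset_uIcc)
    _ = _ := by
        refine intervalIntegral.integral_congr fun t ht => ?_
        rw [uIcc_of_le hyL] at ht
        rw [intervalIntegral.integral_mul_const, hfwd y t hy ht.1]
        rfl

/-- The pair `δ(t - y) + θ(t - y) Ψ₁`, `θ(t - y) Ψ₂` satisfies the backward characteristic identity.
The pulse produces the free term `Q((t + y) / 2) / 2` of the equation for `Ψ₂`, the factor `1 / 2`
being the Jacobian of `s ↦ 2 s - y`. -/
theorem integral_backward_representation (hQ : Continuous Q) (hΨ₁ : Continuous Ψ₁)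
    (hΨ₂ : Continuous Ψ₂) (hφ : Continuous φ)
    (hbwd : ∀ p, Ψ₂ p = Q ((p.2 + p.1) / 2) / 2 + backwardIntegral Q Ψ₁ p)
    (hM : ∀ x, M ≤ |x| → φ x = 0) (hL : R + M ≤ L) {η b : ℝ} (hη : 0 ≤ η)
    (hηL : η ≤ L) (hR : η + b ≤ R) :
    ∫ s in η..L, Q s * (φ (s - (b + η - s)) + ∫ t in s..L, Ψ₁ (s, t) * φ (t - (b + η - s)))
      = ∫ t in η..L, Ψ₂ (η, t) * φ (t - b) := by
  have hz : ∀ t, L ≤ t → φ (t - b) = 0 := fun t ht =>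
    hM _ (le_trans (by linarith) (le_abs_self _))
  -- on the characteristic through `(η, t)` use the abscissa `r = (t + η) / 2` of its diagonal point
  have hinner : ∀ s ∈ Icc η L, ∫ t in s..L, Ψ₁ (s, t) * φ (t - (b + η - s))
      = 2 * ∫ r in s..L, Ψ₁ (s, 2 * r - s) * φ (2 * r - η - b) := by
    intro s hs
    have h1 := intervalIntegral.integral_comp_mul_sub (a := s) (b := L)
      (fun t => Ψ₁ (s, t) * φ (t - (b + η - s))) (c := 2) two_ne_zero s
    rw [show 2 * s - s = s by ring, smul_eq_mul] at h1
    have h2 : ∫ t in s..2 * L - s, Ψ₁ (s, t) * φ (t - (b + η - s))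
        = ∫ t in s..L, Ψ₁ (s, t) * φ (t - (b + η - s)) := by
      refine integral_eq_integral_of_eq_zero_ge (L := L) (by fun_prop) (fun t ht => ?_)
        (by linarith [hs.2]) le_rfl
      rw [show t - (b + η - s) = t - η + s - b by ring, hz _ (by linarith [hs.1]), mul_zero]
    rw [← h2, ← mul_inv_cancel_left₀ (two_ne_zero' ℝ) (∫ t in s..2 * L - s, _), ← h1]
    congr 1
    refine intervalIntegral.integral_congr fun r _ => ?_
    congr 2; ring
  have h3 : ∫ s in η..L,
      Q s * (φ (s - (b + η - s)) + ∫ t in s..L, Ψ₁ (s, t) * φ (t - (b + η - s)))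
      = (∫ r in η..L, Q r * φ (2 * r - η - b))
        + 2 * ∫ s in η..L, ∫ r in s..L, Q s * Ψ₁ (s, 2 * r - s) * φ (2 * r - η - b) := by
    rw [← intervalIntegral.integral_const_mul, ← intervalIntegral.integral_add]
    · refine intervalIntegral.integral_congr fun s hs => ?_
      rw [uIcc_of_le hηL] at hs
      rw [hinner s hs, show s - (b + η - s) = 2 * s - η - b by ring]
      simp only [mul_assoc, intervalIntegral.integral_const_mul]
      ring
    · exact Continuous.intervalIntegrable (by fun_prop) _ _
    · refine Continuous.intervalIntegrable (continuous_const.mul ?_) _ _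
      refine continuous_intervalIntegral_of_continuous ?_ continuous_id continuous_const
      simp only [Function.uncurry_def]; fun_prop
  have h4 := integral_triangle_swap
    (G := fun s r => Q s * Ψ₁ (s, 2 * r - s) * φ (2 * r - η - b))
    (by simp only [Function.uncurry_def]; fun_prop) hηL
  have h5 := intervalIntegral.integral_comp_mul_sub (a := η) (b := L)
    (fun t => Ψ₂ (η, t) * φ (t - b)) (c := 2) two_ne_zero η
  rw [show 2 * η - η = η by ring, smul_eq_mul] at h5
  have h6 : ∫ t in η..2 * L - η, Ψ₂ (η, t) * φ (t - b) = ∫ t in η..L, Ψ₂ (η, t) * φ (t - b) := by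
    refine integral_eq_integral_of_eq_zero_ge (L := L) (by fun_prop) (fun t ht => ?_)
        (by linarith) le_rfl
    rw [hz t ht, mul_zero]
  rw [h3, h4, ← h6, ← mul_inv_cancel_left₀ (two_ne_zero' ℝ) (∫ t in η..2 * L - η, _), ← h5,
    ← intervalIntegral.integral_const_mul, ← intervalIntegral.integral_const_mul,
    ← intervalIntegral.integral_add]
  · refine intervalIntegral.integral_congr fun r _ => ?_
    rw [hbwd, backwardIntegral, intervalIntegral.integral_mul_const]
    simp only [sub_add_cancel]
    rw [mul_div_cancel_left₀ _ (two_ne_zero' ℝ)]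
    ring
  · exact Continuous.intervalIntegrable (by fun_prop) _ _
  · refine Continuous.intervalIntegrable (continuous_const.mul ?_) _ _
    refine continuous_intervalIntegral_of_continuous ?_ continuous_const continuous_id
    simp only [Function.uncurry_def]; fun_prop

end Representation

/-! ### Uniqueness -/

/-- Uniqueness for the homogeneous characteristic system. The region `{y ≥ 0, y + a ≤ R}` contains
the characteristics of its points, and the bounded function `d₁` vanishes on its part `a < -M`. -/
theorem eq_zero_of_homogeneous_system {d₁ d₂ : ℝ → ℝ → ℝ} {q : ℝ → ℝ} {M R L C B : ℝ}
    (hL : R + M ≤ L) (hC : 0 ≤ C) (hq : ∀ s, 0 ≤ s → s ≤ L → |q s| ≤ C)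
    (h0 : ∀ y a, 0 ≤ y → a < -M → d₁ y a = 0)
    (h1 : ∀ y a, 0 ≤ y → y ≤ L → y + a ≤ R → d₁ y a = ∫ η in (0 : ℝ)..y, d₂ η (a + η - y))
    (h2 : ∀ η b, 0 ≤ η → η ≤ L → η + b ≤ R → d₂ η b = ∫ s in η..L, q s * d₁ s (b + η - s))
    (hB : ∀ y a, 0 ≤ y → y + a ≤ R → |d₁ y a| ≤ B) {y a : ℝ} (hy : 0 ≤ y) (hyL : y ≤ L)
    (hya : y + a ≤ R) : d₁ y a = 0 ∧ d₂ y a = 0 := by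
  -- each pass through the system gains the factor `C / l ^ 2 ≤ 1 / 2` in the norm weighted by
  -- `exp (l * a)`
  let l : ℝ := 2 * C + 1
  have hl : 0 < l := by positivity
  have hl2 : C / l ^ 2 ≤ 1 / 2 := by
    rw [div_le_div_iff₀ (by positivity) two_pos]
    simp only [l]; nlinarith
  have hexp : ∀ c₁ c₂ k : ℝ, k ≠ 0 → ∀ x₁ x₂ : ℝ, ∫ x in x₁..x₂, c₁ * Real.exp (c₂ + k * x)
      = c₁ * (Real.exp (c₂ + k * x₂) - Real.exp (c₂ + k * x₁)) / k := by
    intro c₁ c₂ k hk x₁ x₂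
    have hd : ∀ x, HasDerivAt (fun x => c₁ * Real.exp (c₂ + k * x) / k)
        (c₁ * Real.exp (c₂ + k * x)) x := fun x => by
      have h := (((((hasDerivAt_id' x).const_mul k).const_add c₂).exp).const_mul c₁).div_const k
      refine h.congr_deriv ?_
      rw [mul_one, ← mul_assoc, mul_div_cancel_right₀ _ hk]
    rw [intervalIntegral.integral_eq_sub_of_hasDerivAt (fun x _ => hd x)
      (Continuous.intervalIntegrable (by fun_prop) _ _)]
    ring
  have hd₂ : ∀ N, 0 ≤ N → (∀ y a, 0 ≤ y → y + a ≤ R → |d₁ y a| ≤ N * Real.exp (l * a)) →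
      ∀ η b, 0 ≤ η → η ≤ L → η + b ≤ R → |d₂ η b| ≤ C * N / l * Real.exp (l * b) := by
    intro N hN h η b hη hηL hηb
    rw [h2 η b hη hηL hηb, ← Real.norm_eq_abs]
    have h3 : ‖∫ s in η..L, q s * d₁ s (b + η - s)‖
        ≤ ∫ s in η..L, C * N * Real.exp (l * (b + η) + -l * s) := by
      refine intervalIntegral.norm_integral_le_of_norm_le hηL (ae_of_all _ fun s hs => ?_)
        (Continuous.intervalIntegrable (by fun_prop) _ _)
      have hs0 : 0 ≤ s := hη.trans hs.1.le
      rw [norm_mul, Real.norm_eq_abs, Real.norm_eq_abs, mul_assoc]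
      have h4 := h s (b + η - s) hs0 (by linarith)
      rw [show l * (b + η - s) = l * (b + η) + -l * s by ring] at h4
      exact mul_le_mul (hq s hs0 hs.2) h4 (abs_nonneg _) hC
    refine h3.trans ?_
    rw [hexp _ _ _ (neg_ne_zero.2 hl.ne'), show l * (b + η) + -l * η = l * b by ring, div_neg,
      ← neg_div, ← mul_neg, neg_sub, div_mul_eq_mul_div]
    gcongr
    linarith [Real.exp_pos (l * (b + η) + -l * L)]
  have hstep : ∀ N, 0 ≤ N → (∀ y a, 0 ≤ y → y + a ≤ R → |d₁ y a| ≤ N * Real.exp (l * a)) →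
      ∀ y a, 0 ≤ y → y + a ≤ R → |d₁ y a| ≤ N / 2 * Real.exp (l * a) := by
    intro N hN h y a hy hya
    rcases lt_or_ge a (-M) with ha | ha
    · rw [h0 y a hy ha, abs_zero]; positivity
    rw [h1 y a hy (by linarith) hya, ← Real.norm_eq_abs]
    have h3 : ‖∫ η in (0 : ℝ)..y, d₂ η (a + η - y)‖
        ≤ ∫ η in (0 : ℝ)..y, C * N / l * Real.exp (l * (a - y) + l * η) := by
      refine intervalIntegral.norm_integral_le_of_norm_le hy (ae_of_all _ fun η hη => ?_)
        (Continuous.intervalIntegrable (by fun_prop) _ _)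
      rw [Real.norm_eq_abs, show l * (a - y) + l * η = l * (a + η - y) by ring]
      exact hd₂ N hN h η _ hη.1.le (by linarith [hη.2]) (by linarith [hη.2])
    refine h3.trans ?_
    rw [hexp _ _ _ hl.ne', show l * (a - y) + l * y = l * a by ring]
    calc C * N / l * (Real.exp (l * a) - Real.exp (l * (a - y) + l * 0)) / l
        ≤ C * N / l * Real.exp (l * a) / l := by
          gcongr
          linarith [Real.exp_pos (l * (a - y) + l * 0)]
      _ = C / l ^ 2 * (N * Real.exp (l * a)) := by field_simp
      _ ≤ 1 / 2 * (N * Real.exp (l * a)) := by gcongr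
      _ = _ := by ring
  have hB0 : 0 ≤ B := (abs_nonneg _).trans (hB y a hy hya)
  have hall : ∀ k : ℕ, ∀ y a, 0 ≤ y → y + a ≤ R →
      |d₁ y a| ≤ B * Real.exp (l * M) * (1 / 2) ^ k * Real.exp (l * a) := by
    intro k
    induction k with
    | zero =>
      intro y a hy hya
      rcases lt_or_ge a (-M) with ha | ha
      · rw [h0 y a hy ha, abs_zero]; positivity
      · rw [pow_zero, mul_one, mul_assoc, ← Real.exp_add]
        refine (hB y a hy hya).trans (le_mul_of_one_le_right hB0 (Real.one_le_exp ?_))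
        nlinarith
    | succ k ih =>
      intro y a hy hya
      refine (hstep _ (by positivity) ih y a hy hya).trans (le_of_eq ?_)
      ring
  have hd₁ : ∀ y a, 0 ≤ y → y + a ≤ R → d₁ y a = 0 := by
    intro y a hy hya
    have hlim : Tendsto (fun k : ℕ => B * Real.exp (l * M) * (1 / 2) ^ k * Real.exp (l * a)) atTop
        (𝓝 (B * Real.exp (l * M) * 0 * Real.exp (l * a))) :=
      ((tendsto_pow_atTop_nhds_zero_of_lt_one (by norm_num) (by norm_num)).const_mul _).mul_const _
    rw [mul_zero, zero_mul] at hlim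
    exact abs_nonpos_iff.1 (ge_of_tendsto' hlim fun k => hall k y a hy hya)
  refine ⟨hd₁ y a hy hya, ?_⟩
  rw [h2 y a hy hyL hya]
  refine intervalIntegral.integral_zero_ae (ae_of_all _ fun s hs => ?_)
  rw [uIoc_of_le hyL] at hs
  rw [hd₁ s _ (hy.trans hs.1.le) (by linarith), mul_zero]

/-! ### Identification of the distributions with the Goursat solution -/

theorem setIntegral_Ioi_eq_intervalIntegral_of_eq_zero_ge {f : ℝ → ℝ} {y L : ℝ} (hyL : y ≤ L)
    (h : ∀ t, L < t → f t = 0) : ∫ t in Ioi y, f t = ∫ t in y..L, f t := by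
  rw [intervalIntegral.integral_of_le hyL]
  exact setIntegral_eq_of_subset_of_forall_sdiff_eq_zero measurableSet_Ioi
    (fun t ht => ht.1) fun t ht => h t (not_le.1 fun hle => ht.2 ⟨ht.1, hle⟩)

section Identification

variable {W V : ℝ → TimeDistribution} {q Q : ℝ → ℝ} {Ψ₁ Ψ₂ : ℝ × ℝ → ℝ}

/-- A causal solution of the characteristic system with boundary value `δ` is the solution of the
Goursat problem, extended by zero to `t < y`, plus the travelling pulse `δ(t - y)`. -/
theorem isFunctionAfter_of_goursat_solution
    (hcausal : ∀ y, 0 ≤ y → Distribution.IsVanishingOn (W y) (Iio (0 : ℝ)))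
    (hW : ∀ y, 0 ≤ y → HasDerivWithinAt W (V y - ∂_{(1 : ℝ)} (W y)) (Ici 0) y)
    (hV : ∀ y, 0 ≤ y → HasDerivWithinAt V (∂_{(1 : ℝ)} (V y) - q y • W y) (Ici 0) y)
    (hW0 : W 0 = Distribution.delta (0 : ℝ)) (hQ : Continuous Q) (hqQ : ∀ s, 0 ≤ s → q s = Q s)
    (hΨ₁ : Continuous Ψ₁) (hΨ₂ : Continuous Ψ₂)
    (hbwd : ∀ p, Ψ₂ p = Q ((p.2 + p.1) / 2) / 2 + backwardIntegral Q Ψ₁ p)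
    (hfwd : ∀ y t, 0 ≤ y → y ≤ t → Ψ₁ (y, t) = forwardIntegral Ψ₂ (y, t)) {y : ℝ} (hy : 0 ≤ y) :
    IsFunctionAfter (W y - Distribution.delta y) y (fun t => Ψ₁ (y, t)) ∧
      IsFunctionAfter (V y) y (fun t => Ψ₂ (y, t)) := by
  have hWc : ContinuousOn W (Ici 0) := continuousOn_of_forall_hasDerivWithinAt hW
  have hVc : ContinuousOn V (Ici 0) := continuousOn_of_forall_hasDerivWithinAt hV
  have hqc : ContinuousOn q (Ici 0) := hQ.continuousOn.congr fun s hs => hqQ s hs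
  suffices H : ∀ φ : TimeTest, ∃ L, y ≤ L ∧ (∀ t, L < t → φ t = 0) ∧
      W y φ = φ y + ∫ t in y..L, Ψ₁ (y, t) * φ t ∧ V y φ = ∫ t in y..L, Ψ₂ (y, t) * φ t by
    refine ⟨fun φ => ?_, fun φ => ?_⟩
    all_goals
      obtain ⟨L, hyL, hφL, h1, h2⟩ := H φ
      rw [setIntegral_Ioi_eq_intervalIntegral_of_eq_zero_ge hyL fun t ht => by
        rw [hφL t ht, mul_zero]]
    · change W y φ - φ y = _
      rw [h1, add_sub_cancel_left]
    · exact h2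
  intro φ
  have hφ : Continuous φ := φ.continuous
  obtain ⟨M, hM0, hM⟩ := exists_forall_le_abs_eq_zero φ
  -- below, the distributions are tested against all translates `φ(t - a)` with `y + a ≤ R`; the
  -- pairings are those of functions of `t ∈ [y, L]`
  let R : ℝ := y
  let L : ℝ := R + M + 1
  have hL0 : 0 ≤ L := by simp only [L, R]; linarith
  have hLM : R + M ≤ L := by simp only [L]; linarith
  let e₁ : ℝ → ℝ → ℝ := fun y a => φ (y - a) + ∫ t in y..L, Ψ₁ (y, t) * φ (t - a)
  let e₂ : ℝ → ℝ → ℝ := fun y a => ∫ t in y..L, Ψ₂ (y, t) * φ (t - a)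
  have he₁ : Continuous (Function.uncurry e₁) := by
    refine Continuous.add (by fun_prop) ?_
    refine continuous_intervalIntegral_of_continuous ?_ continuous_fst continuous_const
    simp only [Function.uncurry_def]; fun_prop
  have he₂ : Continuous (Function.uncurry e₂) := by
    refine continuous_intervalIntegral_of_continuous ?_ continuous_fst continuous_const
    simp only [Function.uncurry_def]; fun_prop
  let d₁ : ℝ → ℝ → ℝ := fun y a => W y (shift φ a) - e₁ y a
  let d₂ : ℝ → ℝ → ℝ := fun y a => V y (shift φ a) - e₂ y a
  have hd₁ : ContinuousOn (Function.uncurry d₁) (Ici 0 ×ˢ univ) := by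
    refine ContinuousOn.sub ?_ he₁.continuousOn
    exact continuousOn_apply_curve (T := fun p : ℝ × ℝ => W p.1) (f := fun p => shift φ p.2)
      (hWc.comp continuousOn_fst fun p hp => hp.1) ((continuous_shift φ).comp continuous_snd)
  have hW_curve : ∀ b η, ContinuousOn (fun s => W s (shift φ (b + η - s))) (Ici 0) := fun b η =>
    continuousOn_apply_curve hWc ((continuous_shift φ).comp (by fun_prop))
  have hV_curve : ∀ a y, ContinuousOn (fun η => V η (shift φ (a + η - y))) (Ici 0) := fun a y =>
    continuousOn_apply_curve hVc ((continuous_shift φ).comp (by fun_prop))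
  obtain ⟨C, hC⟩ := (isCompact_Icc (a := (0 : ℝ)) (b := L)).exists_bound_of_continuousOn
    (hQ.continuousOn)
  obtain ⟨B, hB⟩ := ((isCompact_Icc (a := (0 : ℝ)) (b := L)).prod
    (isCompact_Icc (a := -M) (b := R))).exists_bound_of_continuousOn
    (hd₁.mono (prod_mono Icc_subset_Ici_self (subset_univ _)))
  have h0 : ∀ y a, 0 ≤ y → a < -M → d₁ y a = 0 := by
    intro y a hy ha
    have hz : ∀ t, 0 ≤ t → φ (t - a) = 0 := fun t ht =>
      hM _ (le_trans (by linarith) (le_abs_self _))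
    have hint : ∫ t in y..L, Ψ₁ (y, t) * φ (t - a) = 0 :=
      intervalIntegral.integral_zero_ae <| ae_of_all _ fun t ht => by
        rw [hz t ((le_min hy hL0).trans ht.1.le), mul_zero]
    simp only [d₁, e₁]
    rw [apply_shift_eq_zero (hcausal y hy) hM ha, hz y hy, hint, add_zero, sub_zero]
  have h1 : ∀ y a, 0 ≤ y → y ≤ L → y + a ≤ R →
      d₁ y a = ∫ η in (0 : ℝ)..y, d₂ η (a + η - y) := by
    intro y a hy hyL hya
    have hsub : Icc 0 y ⊆ Ici (0 : ℝ) := Icc_subset_Ici_self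
    simp only [d₁, d₂]
    have he₂' : Continuous fun η => e₂ η (a + η - y) :=
      he₂.comp (f := fun η => (η, a + η - y)) (by fun_prop)
    rw [intervalIntegral.integral_sub (((hV_curve a y).mono hsub).intervalIntegrable_of_Icc hy)
      (he₂'.intervalIntegrable _ _)]
    simp only [e₂]
    rw [integral_forward_representation hΨ₂ hφ hfwd hM hLM hy hyL hya,
      apply_eq_along_forward_characteristic hW hVc _ hy, hW0]
    have hδ : (Distribution.delta (0 : ℝ) : TimeDistribution) (shift (shift φ a) (-y))
        = φ (y - a) := by
      change shift (shift φ a) (-y) 0 = _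
      rw [shift_shift, shift_apply]
      congr 1; ring
    rw [hδ]
    simp only [shift_shift, e₁, add_sub_assoc]
    ring
  have h2 : ∀ η b, 0 ≤ η → η ≤ L → η + b ≤ R →
      d₂ η b = ∫ s in η..L, q s * d₁ s (b + η - s) := by
    intro η b hη hηL hηb
    have hsub : Icc η L ⊆ Ici (0 : ℝ) := fun s hs => hη.trans hs.1
    have hrep := integral_backward_representation hQ hΨ₁ hΨ₂ hφ hbwd hM hLM hη hηL hηb
    have hcongr : ∫ s in η..L, Q s * e₁ s (b + η - s) = ∫ s in η..L, q s * e₁ s (b + η - s) := by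
      refine intervalIntegral.integral_congr fun s hs => ?_
      rw [uIcc_of_le hηL] at hs
      rw [hqQ s (hη.trans hs.1)]
    simp only [d₁, d₂, mul_sub]
    have he₁' : Continuous fun s => e₁ s (b + η - s) :=
      he₁.comp (f := fun s => (s, b + η - s)) (by fun_prop)
    have hI : IntervalIntegrable (fun s => q s * W s (shift φ (b + η - s))) volume η L :=
      ((hqc.mul (hW_curve b η)).mono hsub).intervalIntegrable_of_Icc hηL
    have hJ : IntervalIntegrable (fun s => q s * e₁ s (b + η - s)) volume η L :=
      ((hqc.mul he₁'.continuousOn).mono hsub).intervalIntegrable_of_Icc hηL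
    rw [intervalIntegral.integral_sub hI hJ, ← hcongr]
    simp only [e₁]
    rw [hrep, apply_eq_along_backward_characteristic hWc hqc hV _ hη hηL]
    -- at the far end `L` of the characteristic the test function lives in `t < 0`
    rw [shift_shift, apply_shift_eq_zero (vanishing_of_causal hcausal hW hL0) hM
      (by simp only [L]; linarith), zero_add]
    simp only [shift_shift, e₂, add_sub_assoc]
  have hbound : ∀ y a, 0 ≤ y → y + a ≤ R → |d₁ y a| ≤ max B 0 := by
    intro y a hy hya
    rcases lt_or_ge a (-M) with ha | ha
    · rw [h0 y a hy ha, abs_zero]; exact le_max_right _ _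
    · exact (hB (y, a) ⟨⟨hy, by linarith⟩, ha, by linarith⟩).trans (le_max_left _ _)
  have hC0 : 0 ≤ C := (norm_nonneg _).trans (hC 0 ⟨le_rfl, hL0⟩)
  have hyL : y ≤ L := by simp only [L, R]; linarith
  obtain ⟨hz₁, hz₂⟩ := eq_zero_of_homogeneous_system hLM hC0
    (fun s hs hsL => by rw [hqQ s hs]; exact hC s ⟨hs, hsL⟩) h0 h1 h2 hbound hy hyL
    (show y + 0 ≤ R by simp only [R, add_zero]; exact le_rfl)
  refine ⟨L, hyL, fun t ht => hM t ((le_trans ?_ ht.le).trans (le_abs_self t)), ?_, ?_⟩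
  · linarith
  · simpa only [d₁, e₁, shift_zero, sub_zero, sub_eq_zero] using hz₁
  · simpa only [d₂, e₂, shift_zero, sub_zero, sub_eq_zero] using hz₂

end Identification

/-! ### The integral equations -/

theorem proposition1 (n : ℝ → ℝ) (ρ : ℝ) (ξ : EuclideanSpace ℝ (Fin 2))
    (U : ℝ → TimeDistribution)
    (hρ : 0 < ρ)
    (hn : ContDiffOn ℝ 2 n (Ici 0))
    (hn_pos : ∀ z : ℝ, 0 ≤ z → 0 < n z)
    (hn_tt : Tendsto (travelTime n) atTop atTop)
    (hU : IsZeroOrderSolution n ρ ξ U) :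
    ∃ (ψ₁ ψ₂ : ℝ → ℝ → ℝ) (g : ℝ → ℝ),
      -- `ψ₁`, `ψ₂`, `g` and `q` are continuous functions, up to the boundary
      ContinuousOn (fun p : ℝ × ℝ => ψ₁ p.1 p.2) {p | 0 ≤ p.1 ∧ p.1 ≤ p.2} ∧
      ContinuousOn (fun p : ℝ × ℝ => ψ₂ p.1 p.2) {p | 0 ≤ p.1 ∧ p.1 ≤ p.2} ∧
      ContinuousOn g (Ici 0) ∧
      ContinuousOn (potential n ρ ξ) (Ici 0) ∧
      -- they represent `√σ U`, `∂ₜ(√σ U) + ∂_y(√σ U)` and the data built from the response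
      (∀ y : ℝ, 0 ≤ y →
        IsFunctionAfter (psiOne n ρ U y - Distribution.delta y) y (ψ₁ y)) ∧
      (∀ y : ℝ, 0 ≤ y → IsFunctionAfter (psiTwo n ρ U y) y (ψ₂ y)) ∧
      IsFunctionAfter (dataG n ρ (response n U)) 0 g ∧
      -- the three integral equations
      (∀ y t : ℝ, 0 ≤ y → y ≤ t →
        ψ₁ y t = ∫ η in (0 : ℝ)..y, ψ₂ η (t + η - y)) ∧
      (∀ y t : ℝ, 0 ≤ y → y ≤ t →
        ψ₂ y t = -(∫ η in (0 : ℝ)..y, potential n ρ ξ η * ψ₁ η (t - η + y)) + g (t + y)) ∧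
      (∀ y : ℝ, 0 ≤ y →
        potential n ρ ξ y =
          -2 * (∫ η in (0 : ℝ)..y, potential n ρ ξ η * ψ₁ η (2 * y - η)) + 2 * g (2 * y)) := by
  have hN := contDiffOn_indexTT hn hn_pos hn_tt
  have hpos : ∀ y, 0 ≤ y → 0 < indexTT n y := fun y hy =>
    indexTT_pos hn.continuousOn hn_pos hn_tt hy
  have hq := continuousOn_potential (ξ := ξ) hN hρ hpos
  let Q : ℝ → ℝ := fun s => potential n ρ ξ (max s 0)
  have hQ : Continuous Q :=
    hq.comp_continuous (f := fun s => max s 0) (by fun_prop) fun s => le_max_right s 0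
  have hqQ : ∀ s, 0 ≤ s → potential n ρ ξ s = Q s := fun s hs => by
    simp only [Q, max_eq_left hs]
  obtain ⟨Ψ₁, Ψ₂, hΨ₁, hΨ₂, hbwd, hfwd⟩ := exists_goursat_solution hQ
  have hrep := fun y (hy : 0 ≤ y) => isFunctionAfter_of_goursat_solution
    (fun y hy φ hφ => by
      change √(admittance n ρ y) • U y φ = 0
      rw [hU.causal y hy φ hφ, smul_zero])
    (fun y hy => hasDerivWithinAt_psiOne' hN hρ hpos hU hy)
    (fun y hy => hasDerivWithinAt_psiTwo hN hρ hpos hU hy)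
    (psiOne_zero hρ (hpos 0 le_rfl) hU) hQ hqQ hΨ₁ hΨ₂ hbwd hfwd hy
  -- the characteristic through the boundary point `(0, u)`
  have hdata : ∀ u, Ψ₂ (0, u) = Q (u / 2) / 2 + ∫ s in (0 : ℝ)..u / 2, Q s * Ψ₁ (s, u - s) := by
    intro u
    rw [hbwd, backwardIntegral]
    simp only [add_zero]
  have hqΨ : ∀ y u, 0 ≤ y → ∫ η in (0 : ℝ)..y, potential n ρ ξ η * Ψ₁ (η, u - η)
      = ∫ η in (0 : ℝ)..y, Q η * Ψ₁ (η, u - η) := by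
    intro y u hy
    refine intervalIntegral.integral_congr fun s hs => ?_
    rw [uIcc_of_le hy] at hs
    rw [hqQ s hs.1]
  refine ⟨fun y t => Ψ₁ (y, t), fun y t => Ψ₂ (y, t), fun t => Ψ₂ (0, t), hΨ₁.continuousOn,
    hΨ₂.continuousOn, Continuous.continuousOn (by fun_prop), hq, fun y hy => (hrep y hy).1,
    fun y hy => (hrep y hy).2, ?_, hfwd, fun y t hy _ => ?_, fun y hy => ?_⟩
  · rw [← psiTwo_zero hN hρ hpos hU]
    exact (hrep 0 le_rfl).2
  · have hc : ∀ a b, IntervalIntegrable (fun s => Q s * Ψ₁ (s, t + y - s)) volume a b := fun a b =>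
      Continuous.intervalIntegrable (by fun_prop) a b
    simp only [sub_add_eq_add_sub]
    rw [hqΨ y (t + y) hy, hdata, hbwd, backwardIntegral,
      ← intervalIntegral.integral_add_adjacent_intervals (hc 0 y) (hc y ((t + y) / 2))]
    ring
  · beta_reduce
    rw [hqΨ y (2 * y) hy, hdata, mul_div_cancel_left₀ _ (two_ne_zero' ℝ), hqQ y hy]
    ring

end
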